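/- Let $\lambda:\mathbb{R}\to\mathbb{R}$ be a $C^\infty$ function such that (1) $\lambda(x)=0$ for $x\le 0$; (2) $\lambda(x)>1$ for $x>1$; (3) $\lambda''(x)\ge 100\,\lambda'(x)$ for all $x$; (4) $\lambda''(x)>0$ for $x>0$; (5) $\lambda'(x)>100$ whenever $\lambda(x)>\frac12$. For $r>1$ let $$\rho_r(z,w)=\left|w+e^{i\log|z|^2}\right|^2-1+\lambda\!\left(\frac1{|z|^2}-1\right)+\lambda\left(|z|^2-r^2\right)\qquad(z\in\mathbb{C}\setminus\{0\},\ w\in\mathbb{C}),$$ and let $\Omega_r=\{(z,w)\in(\mathbb{C}\setminus\{0\})\times\mathbb{C}:\rho_r(z,w)<0\}$ be the Diederich–Fornæss worm domain. A $C^k$ defining function for an open set $\Omega\subset\mathbb{C}^2$ is a real-valued function $\rho$, of class $C^k$ on a neighborhood $U$ of $\overline\Omega$, with $\Omega=\{p\in U:\rho(p)<0\}$ and $d\rho\ne0$ on $b\Omega$. A number $\tau\in(0,1)$ is a Diederich–Fornæss exponent for $\Omega$ if there is a $C^\infty$ defining function $\rho$ for $\Omega$ such that $-(-\rho)^\tau$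 is plurisubharmonic on $\Omega$, and the Diederich–Fornæss index of $\Omega$ is the supremum of its Diederich–Fornæss exponents. A set $\Omega$ with $C^2$ boundary is pseudoconvex if at every boundary point the Levi form of every $C^2$ defining function is nonnegative on complex tangent vectors; a boundary point is weakly pseudoconvex if the Levi form is nonnegative but not positive definite there. Then $\Omega_r$ is pseudoconvex, its set of weakly pseudoconvex boundary points is the annulus $M_r=\{(z,w):1\le|z|\le r,\ w=0\}$, and its Diederich–Fornæss index equals $$\frac{\pi}{\log r^2+\pi}.$$ -/

import Mathlib

open scoped ContDiff ComplexConjugate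

namespace Worm

/-- The complex coordinate directions of `ℂ × ℂ`: `(1, 0)` for `z` and `(0, 1)` for `w`. -/
def e : Fin 2 → ℂ × ℂ := ![(1, 0), (0, 1)]

/-- The coordinates `(t₁, t₂)` of a vector `t` of `ℂ × ℂ`. -/
def coord (t : ℂ × ℂ) : Fin 2 → ℂ := ![t.1, t.2]

/-- The Wirtinger derivative `∂f/∂z_j = (∂f/∂x_j - i ∂f/∂y_j) / 2`. -/
noncomputable def dz (j : Fin 2) (f : ℂ × ℂ → ℂ) (p : ℂ × ℂ) : ℂ :=
  (fderiv ℝ f p (e j) - Complex.I * fderiv ℝ f p (Complex.I • e j)) / 2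

/-- The Wirtinger derivative `∂f/∂z̄_j = (∂f/∂x_j + i ∂f/∂y_j) / 2`. -/
noncomputable def dzbar (j : Fin 2) (f : ℂ × ℂ → ℂ) (p : ℂ × ℂ) : ℂ :=
  (fderiv ℝ f p (e j) + Complex.I * fderiv ℝ f p (Complex.I • e j)) / 2

/-- The complex Hessian form `∑ⱼₖ (∂²f/∂z_j ∂z̄_k)(p) t_j t̄_k` of a real function `f`. (For `f` of
class `C²` near `p` the sum is real; the real part only turns it into a real number.) -/
noncomputable def leviForm (f : ℂ × ℂ → ℝ) (p t : ℂ × ℂ) : ℝ :=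
  (∑ j : Fin 2, ∑ k : Fin 2,
    dz j (dzbar k (fun q => (f q : ℂ))) p * coord t j * conj (coord t k)).re

/-- `∑ⱼ (∂f/∂z_j)(p) t_j = 0`: the vector `t` is complex tangential to the level set of `f`. -/
def IsComplexTangent (f : ℂ × ℂ → ℝ) (p t : ℂ × ℂ) : Prop :=
  ∑ j : Fin 2, dz j (fun q => (f q : ℂ)) p * coord t j = 0

/-- `ρ` is a defining function of class `C^n` for `Ω`: it is `C^n` on a neighborhood `U` of the
closure of `Ω`, `Ω = {ρ < 0}`, and `dρ ≠ 0` on the boundary. -/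
def IsDefiningFunction (n : WithTop ℕ∞) (Ω : Set (ℂ × ℂ)) (ρ : ℂ × ℂ → ℝ) : Prop :=
  ∃ U : Set (ℂ × ℂ), IsOpen U ∧ closure Ω ⊆ U ∧ ContDiffOn ℝ n ρ U ∧
    Ω = {p | p ∈ U ∧ ρ p < 0} ∧ ∀ p ∈ frontier Ω, fderiv ℝ ρ p ≠ 0

/-- A function is `C²` and plurisubharmonic on the (open) set `Ω`. -/
def IsPlurisubharmonicOn (φ : ℂ × ℂ → ℝ) (Ω : Set (ℂ × ℂ)) : Prop :=
  ContDiffOn ℝ 2 φ Ω ∧ ∀ p ∈ Ω, ∀ t : ℂ × ℂ, 0 ≤ leviForm φ p t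

/-- The Levi form of every `C²` defining function is nonnegative at the boundary point `p`. -/
def IsPseudoconvexAt (Ω : Set (ℂ × ℂ)) (p : ℂ × ℂ) : Prop :=
  ∀ ρ : ℂ × ℂ → ℝ, IsDefiningFunction 2 Ω ρ →
    ∀ t : ℂ × ℂ, IsComplexTangent ρ p t → 0 ≤ leviForm ρ p t

/-- The Levi form of every `C²` defining function is positive definite at the boundary point `p`. -/
def IsStrictlyPseudoconvexAt (Ω : Set (ℂ × ℂ)) (p : ℂ × ℂ) : Prop :=
  ∀ ρ : ℂ × ℂ → ℝ, IsDefiningFunction 2 Ω ρ →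
    ∀ t : ℂ × ℂ, t ≠ 0 → IsComplexTangent ρ p t → 0 < leviForm ρ p t

/-- `Ω` has `C²` boundary and is (Levi) pseudoconvex. -/
def IsPseudoconvex (Ω : Set (ℂ × ℂ)) : Prop :=
  (∃ ρ : ℂ × ℂ → ℝ, IsDefiningFunction 2 Ω ρ) ∧ ∀ p ∈ frontier Ω, IsPseudoconvexAt Ω p

/-- The boundary points at which `Ω` is pseudoconvex but not strictly pseudoconvex. -/
def weaklyPseudoconvexPoints (Ω : Set (ℂ × ℂ)) : Set (ℂ × ℂ) :=
  {p | p ∈ frontier Ω ∧ IsPseudoconvexAt Ω p ∧ ¬ IsStrictlyPseudoconvexAt Ω p}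

/-- `τ ∈ (0, 1)` is a Diederich–Fornæss exponent for `Ω`: there is a smooth defining function `ρ`
such that `-(-ρ)^τ` is plurisubharmonic on `Ω`. -/
def IsDFExponent (Ω : Set (ℂ × ℂ)) (τ : ℝ) : Prop :=
  0 < τ ∧ τ < 1 ∧ ∃ ρ : ℂ × ℂ → ℝ, IsDefiningFunction ∞ Ω ρ ∧
    IsPlurisubharmonicOn (fun p => -((-ρ p) ^ τ)) Ω

/-- The Diederich–Fornæss index: the supremum of all Diederich–Fornæss exponents. -/
noncomputable def dfIndex (Ω : Set (ℂ × ℂ)) : ℝ := sSup {τ : ℝ | IsDFExponent Ω τ}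

/-- The conditions on the cut-off function used to construct a worm domain. -/
structure IsWormProfile (lam : ℝ → ℝ) : Prop where
  smooth : ContDiff ℝ ∞ lam
  eq_zero : ∀ x, x ≤ 0 → lam x = 0
  one_lt : ∀ x, 1 < x → 1 < lam x
  le_deriv_deriv : ∀ x, 100 * deriv lam x ≤ deriv (deriv lam) x
  deriv_deriv_pos : ∀ x, 0 < x → 0 < deriv (deriv lam) x
  lt_deriv : ∀ x, 1 / 2 < lam x → 100 < deriv lam x

/-- `ρ_r(z, w) = |w + e^{i log (z z̄)}|² - 1 + λ(1/|z|² - 1) + λ(|z|² - r²)`, for `z ≠ 0`. -/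
noncomputable def wormFunction (lam : ℝ → ℝ) (r : ℝ) (p : ℂ × ℂ) : ℝ :=
  ‖p.2 + Complex.exp (Complex.I * (Real.log (‖p.1‖ ^ 2) : ℂ))‖ ^ 2 - 1
    + lam (1 / ‖p.1‖ ^ 2 - 1) + lam (‖p.1‖ ^ 2 - r ^ 2)

/-- The worm domain `{ρ_r < 0}`. The formula for `ρ_r` has no meaning at `z = 0` (it tends to `+∞`
there), so these points are excluded explicitly. -/
def wormDomain (lam : ℝ → ℝ) (r : ℝ) : Set (ℂ × ℂ) :=
  {p | p.1 ≠ 0 ∧ wormFunction lam r p < 0}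

end Worm

/-!
In the frame `z ∂/∂z`, `e^{i log |z|²} ∂/∂w` the Levi form of `ρ_r` on complex tangent vectors is,
up to a positive factor, a sum of squares plus convexity terms of the two cut-offs, and it vanishes
exactly over the annulus `w = 0`.

*Lower bound for the index.* Multiply `ρ_r` by a weight `m (log |z|)`. On the annulus,
plurisubharmonicity of `-(-m ρ_r)^τ` becomes a Riccati inequality for `(log m)'`. It is solved by a
power of `cos (2 k (x - log r / 2))` with `k > τ / (1 - τ)`, provided that this cosine is positive
on `[0, log r]`, which leaves room for such a `k` when `2 τ / (1 - τ) * log r < π`. Strict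
inequality on the annulus survives nearby, strict pseudoconvexity takes care of the rest of a
neighbourhood of the boundary, and a convex truncation of `-(-m ρ_r)^τ` removes the condition
further inside.

*Upper bound.* Let `ρ` be any defining function for which `-(-ρ)^τ` is plurisubharmonic. The curves
`ζ ↦ (e^{c + ζ}, -ε e^{2 i c + 2 i (1 + k) ζ})` collapse onto the annulus as `ε → 0`, in a direction
making the angle `2 k Re ζ` with the inner normal. Along them `(-ρ)^τ / ε^τ` is superharmonic and
tends to `(A(z) e^{-2 (1 + k) Im ζ} cos (2 k Re ζ))^τ`, where `A > 0` depends only on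
`z = e^{c + ζ}`, hence is periodic in `Im ζ`. If `K := τ (1 + k) > k`, the barrier
`e^{-2 K Im ζ} cos (2 k Re ζ)` is strictly subharmonic, and since `τ < 1` its quotient by this limit
tends to zero where the cosine vanishes. A suitable multiple of it therefore touches the limit from
below at an interior point of the strip, and for small `ε` this contradicts the maximum principle.
Such a `k` fits on the annulus as soon as `2 τ / (1 - τ) * log r > π`.
-/

namespace Worm

open Filter Topology

section TwoJet

/-- `g` is differentiable near `s`, with first derivative `b` and second derivative `c` at `s`.
The two-jets of a function along curves give access to its complex Hessian. -/
structure HasTwoJetAt (g : ℝ → ℝ) (b c s : ℝ) : Prop where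
  eventually_differentiableAt : ∀ᶠ x in 𝓝 s, DifferentiableAt ℝ g x
  hasDerivAt : HasDerivAt g b s
  hasDerivAt_deriv : HasDerivAt (deriv g) c s

namespace HasTwoJetAt

variable {f g : ℝ → ℝ} {b c b' c' s : ℝ}

lemma of_hasDerivAt {g' : ℝ → ℝ} (hg : ∀ᶠ x in 𝓝 s, HasDerivAt g (g' x) x)
    (hg' : HasDerivAt g' c s) : HasTwoJetAt g (g' s) c s where
  eventually_differentiableAt := hg.mono fun _ hx ↦ hx.differentiableAt
  hasDerivAt := hg.self_of_nhds
  hasDerivAt_deriv := hg'.congr_of_eventuallyEq (hg.mono fun _ hx ↦ hx.deriv)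

lemma of_contDiffAt (hg : ContDiffAt ℝ 2 g s) :
    HasTwoJetAt g (deriv g s) (deriv (deriv g) s) s :=
  have hg' : ContDiffAt ℝ 1 (deriv g) s :=
    (hg.fderiv_right (m := 1) (by norm_num)).clm_apply contDiffAt_const
  of_hasDerivAt
    ((hg.eventually (by simp)).mono fun _ hx ↦ (hx.differentiableAt (by simp)).hasDerivAt)
    (hg'.differentiableAt (by simp)).hasDerivAt

lemma congr_of_eventuallyEq (hg : HasTwoJetAt g b c s) (hfg : f =ᶠ[𝓝 s] g) :
    HasTwoJetAt f b c s where
  eventually_differentiableAt := by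
    filter_upwards [hg.eventually_differentiableAt, hfg.eventuallyEq_nhds] with x hx hx'
    exact hx.congr_of_eventuallyEq hx'
  hasDerivAt := hg.hasDerivAt.congr_of_eventuallyEq hfg
  hasDerivAt_deriv := hg.hasDerivAt_deriv.congr_of_eventuallyEq hfg.deriv

lemma congr_jet (hg : HasTwoJetAt g b c s) (hb : b = b') (hc : c = c') :
    HasTwoJetAt g b' c' s :=
  hb ▸ hc ▸ hg

lemma unique (h : HasTwoJetAt g b c s) (h' : HasTwoJetAt g b' c' s) : b = b' ∧ c = c' :=
  ⟨h.hasDerivAt.unique h'.hasDerivAt, h.hasDerivAt_deriv.unique h'.hasDerivAt_deriv⟩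

lemma const (k s : ℝ) : HasTwoJetAt (fun _ ↦ k) 0 0 s :=
  of_hasDerivAt (g' := fun _ ↦ 0) (.of_forall fun x ↦ hasDerivAt_const x k) (hasDerivAt_const s 0)

lemma affine (k m s : ℝ) : HasTwoJetAt (fun x ↦ k + m * x) m 0 s :=
  of_hasDerivAt (g' := fun _ ↦ m)
    (.of_forall fun x ↦ by simpa using ((hasDerivAt_id x).const_mul m).const_add k)
    (hasDerivAt_const s m)

lemma add (hf : HasTwoJetAt f b c s) (hg : HasTwoJetAt g b' c' s) :
    HasTwoJetAt (fun x ↦ f x + g x) (b + b') (c + c') s where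
  eventually_differentiableAt :=
    (hf.eventually_differentiableAt.and hg.eventually_differentiableAt).mono fun _ hx ↦
      hx.1.add hx.2
  hasDerivAt := hf.hasDerivAt.add hg.hasDerivAt
  hasDerivAt_deriv := by
    refine (hf.hasDerivAt_deriv.add hg.hasDerivAt_deriv).congr_of_eventuallyEq ?_
    filter_upwards [hf.eventually_differentiableAt, hg.eventually_differentiableAt] with x hfx hgx
    exact (hfx.hasDerivAt.add hgx.hasDerivAt).deriv

lemma mul (hf : HasTwoJetAt f b c s) (hg : HasTwoJetAt g b' c' s) :
    HasTwoJetAt (fun x ↦ f x * g x) (b * g s + f s * b')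
      (c * g s + 2 * (b * b') + f s * c') s where
  eventually_differentiableAt :=
    (hf.eventually_differentiableAt.and hg.eventually_differentiableAt).mono fun _ hx ↦
      hx.1.mul hx.2
  hasDerivAt := hf.hasDerivAt.mul hg.hasDerivAt
  hasDerivAt_deriv := by
    have h := (hf.hasDerivAt_deriv.mul hg.hasDerivAt).add (hf.hasDerivAt.mul hg.hasDerivAt_deriv)
    rw [hf.hasDerivAt.deriv, hg.hasDerivAt.deriv] at h
    refine (h.congr_of_eventuallyEq ?_).congr_deriv (by ring)
    filter_upwards [hf.eventually_differentiableAt, hg.eventually_differentiableAt] with x hfx hgx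
    exact (hfx.hasDerivAt.mul hgx.hasDerivAt).deriv

lemma const_mul (k : ℝ) (hg : HasTwoJetAt g b c s) :
    HasTwoJetAt (fun x ↦ k * g x) (k * b) (k * c) s :=
  ((const k s).mul hg).congr_jet (by ring) (by ring)

lemma neg (hg : HasTwoJetAt g b c s) : HasTwoJetAt (fun x ↦ -g x) (-b) (-c) s := by
  simpa using hg.const_mul (-1)

lemma sub (hf : HasTwoJetAt f b c s) (hg : HasTwoJetAt g b' c' s) :
    HasTwoJetAt (fun x ↦ f x - g x) (b - b') (c - c') s := by
  simpa only [sub_eq_add_neg] using hf.add hg.neg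

lemma sq (hg : HasTwoJetAt g b c s) :
    HasTwoJetAt (fun x ↦ g x ^ 2) (2 * g s * b) (2 * b ^ 2 + 2 * g s * c) s := by
  simpa only [← pow_two] using (hg.mul hg).congr_jet (by ring) (by ring)

lemma comp (hf : HasTwoJetAt f b c (g s)) (hg : HasTwoJetAt g b' c' s) :
    HasTwoJetAt (fun x ↦ f (g x)) (b * b') (c * b' ^ 2 + b * c') s where
  eventually_differentiableAt := by
    filter_upwards [hg.hasDerivAt.continuousAt.eventually hf.eventually_differentiableAt,
      hg.eventually_differentiableAt] with x hfx hgx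
    exact hfx.comp x hgx
  hasDerivAt := hf.hasDerivAt.comp s hg.hasDerivAt
  hasDerivAt_deriv := by
    have h := (hf.hasDerivAt_deriv.comp s hg.hasDerivAt).mul hg.hasDerivAt_deriv
    simp only [Function.comp_apply] at h
    rw [hf.hasDerivAt.deriv, hg.hasDerivAt.deriv] at h
    refine (h.congr_of_eventuallyEq ?_).congr_deriv (by ring)
    filter_upwards [hg.hasDerivAt.continuousAt.eventually hf.eventually_differentiableAt,
      hg.eventually_differentiableAt] with x hfx hgx
    exact (hfx.hasDerivAt.comp x hgx.hasDerivAt).deriv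

lemma comp_curve {E : Type*} [NormedAddCommGroup E] [NormedSpace ℝ E] {F : E → ℝ}
    {γ γ' : ℝ → E} {γ'' : E} (hF : ContDiffAt ℝ 2 F (γ s)) (hγ : ∀ x, HasDerivAt γ (γ' x) x)
    (hγ' : HasDerivAt γ' γ'' s) :
    HasTwoJetAt (fun x ↦ F (γ x)) (fderiv ℝ F (γ s) (γ' s))
      (fderiv ℝ (fderiv ℝ F) (γ s) (γ' s) (γ' s) + fderiv ℝ F (γ s) γ'') s := by
  refine of_hasDerivAt (g' := fun x ↦ fderiv ℝ F (γ x) (γ' x)) ?_ ?_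
  · filter_upwards [(hγ s).continuousAt.eventually (hF.eventually (by simp))] with x hx
    exact (hx.differentiableAt (by simp)).hasFDerivAt.comp_hasDerivAt x (hγ x)
  · have hF' : ContDiffAt ℝ 1 (fderiv ℝ F) (γ s) := hF.fderiv_right (by norm_num)
    exact ((hF'.differentiableAt (by simp)).hasFDerivAt.comp_hasDerivAt s (hγ s)).clm_apply hγ'

lemma eventually_lt (hg : HasTwoJetAt g 0 c s) (hc : 0 < c) : ∀ᶠ x in 𝓝[≠] s, g s < g x := by
  -- Subtracting `c / 4 * (x - s) ^ 2` leaves a function which still has a local minimum at `s`.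
  have hparabola := (affine (-s) 1 s).sq.const_mul (c / 4)
  have hdiff := hg.sub hparabola
  have hmin : IsLocalMin (fun x ↦ g x - c / 4 * (-s + 1 * x) ^ 2) s :=
    isLocalMin_of_deriv_deriv_pos (by rw [hdiff.hasDerivAt_deriv.deriv]; linarith)
      (by rw [hdiff.hasDerivAt.deriv]; ring) hdiff.hasDerivAt.continuousAt
  filter_upwards [hmin.filter_mono nhdsWithin_le_nhds, self_mem_nhdsWithin] with x hx hne
  have hsq : 0 < (x - s) ^ 2 := by have := sub_ne_zero.2 hne; positivity
  nlinarith

lemma nonpos_of_isLocalMax (hg : HasTwoJetAt g b c s) (hmax : IsLocalMax g s) : c ≤ 0 := by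
  by_contra! hc
  obtain rfl : b = 0 := hmax.hasDerivAt_eq_zero hg.hasDerivAt
  obtain ⟨x, hlt, hle⟩ :=
    ((hg.eventually_lt hc).and (hmax.filter_mono nhdsWithin_le_nhds)).exists
  exact hlt.not_ge hle

end HasTwoJetAt

end TwoJet

section QuadraticCurve

variable {E : Type*} [NormedAddCommGroup E] [NormedSpace ℝ E] {f : E → ℝ} {p : E}

lemma hasTwoJetAt_quadratic_curve (hf : ContDiffAt ℝ 2 f p) (v n : E) (c : ℝ) :
    HasTwoJetAt (fun x : ℝ ↦ f (p + x • v + (c * x ^ 2) • n)) (fderiv ℝ f p v)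
      (fderiv ℝ (fderiv ℝ f) p v v + 2 * c * fderiv ℝ f p n) 0 := by
  have hγ (x : ℝ) :
      HasDerivAt (fun x : ℝ ↦ p + x • v + (c * x ^ 2) • n) (v + (2 * c * x) • n) x := by
    refine ((((hasDerivAt_id x).smul_const v).const_add p).add
      (((hasDerivAt_pow 2 x).const_mul c).smul_const n)).congr_deriv ?_
    simp only [one_smul, Nat.add_one_sub_one, pow_one, Nat.cast_ofNat]
    ring_nf
  have hγ' : HasDerivAt (fun x : ℝ ↦ v + (2 * c * x) • n) ((2 * c) • n) 0 := by
    simpa using (((hasDerivAt_id (0 : ℝ)).const_mul (2 * c)).smul_const n).const_add v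
  simpa using HasTwoJetAt.comp_curve (F := f) (s := 0) (by simpa using hf) hγ hγ'

lemma hasTwoJetAt_line (hf : ContDiffAt ℝ 2 f p) (v : E) :
    HasTwoJetAt (fun x : ℝ ↦ f (p + x • v)) (fderiv ℝ f p v) (fderiv ℝ (fderiv ℝ f) p v v) 0 := by
  simpa using hasTwoJetAt_quadratic_curve hf v 0 0

lemma tendsto_quadratic_curve (p v n : E) (c : ℝ) :
    Tendsto (fun x : ℝ ↦ p + x • v + (c * x ^ 2) • n) (𝓝 0) (𝓝 p) := by
  have : Continuous fun x : ℝ ↦ p + x • v + (c * x ^ 2) • n := by fun_prop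
  simpa using this.tendsto 0

end QuadraticCurve

section NegativeSet

variable {E : Type*} [NormedAddCommGroup E] [NormedSpace ℝ E] {f g : E → ℝ} {p v : E}

lemma eventually_pos_of_fderiv_pos (hg : DifferentiableAt ℝ g p) (hg0 : g p = 0)
    (hv : 0 < fderiv ℝ g p v) : ∀ᶠ x in 𝓝[>] (0 : ℝ), 0 < g (p + x • v) := by
  have hline : HasDerivAt (fun x : ℝ ↦ g (p + x • v)) (fderiv ℝ g p v) 0 := by
    have hγ : HasDerivAt (fun x : ℝ ↦ p + x • v) v 0 := by
      simpa using ((hasDerivAt_id (0 : ℝ)).smul_const v).const_add p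
    have hg' : HasFDerivAt g (fderiv ℝ g p) (p + (0 : ℝ) • v) := by simpa using hg.hasFDerivAt
    exact hg'.comp_hasDerivAt (0 : ℝ) hγ
  have hsign := eventually_nhdsWithin_sign_eq_of_deriv_pos (hline.deriv.symm ▸ hv) (by simpa)
  filter_upwards [hsign.filter_mono nhdsWithin_le_nhds, self_mem_nhdsWithin] with x hx hx0
  rwa [sub_zero, sign_pos (Set.mem_Ioi.1 hx0), sign_eq_one_iff] at hx

lemma fderiv_nonpos_of_fderiv_neg (hf : DifferentiableAt ℝ f p) (hg : DifferentiableAt ℝ g p)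
    (hf0 : f p = 0) (hg0 : g p = 0) (hfg : ∀ᶠ q in 𝓝 p, f q < 0 → g q < 0)
    (hv : fderiv ℝ f p v < 0) : fderiv ℝ g p v ≤ 0 := by
  by_contra! hpos
  have hf_neg := eventually_pos_of_fderiv_pos (g := -f) (v := v) hf.neg (by simpa using hf0)
    (by simpa [fderiv_neg] using hv)
  have hline : Tendsto (fun x : ℝ ↦ p + x • v) (𝓝[>] 0) (𝓝 p) := by
    simpa using (tendsto_quadratic_curve p v 0 0).mono_left nhdsWithin_le_nhds
  obtain ⟨x, hfx, hgx, hx⟩ := (hf_neg.and ((eventually_pos_of_fderiv_pos hg hg0 hpos).and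
    (hline.eventually hfg))).exists
  exact (hx (by simpa using hfx)).not_gt hgx

lemma exists_apply_eq_one {V : Type*} [AddCommGroup V] [Module ℝ V] {L : V →ₗ[ℝ] ℝ} (hL : L ≠ 0) :
    ∃ n, L n = 1 :=
  LinearMap.surjective hL 1

lemma exists_pos_eq_smul_of_neg_imp_nonpos {V : Type*} [AddCommGroup V] [Module ℝ V]
    {L M : V →ₗ[ℝ] ℝ} (hL : L ≠ 0) (hM : M ≠ 0) (hLM : ∀ v, L v < 0 → M v ≤ 0) :
    ∃ h : ℝ, 0 < h ∧ M = h • L := by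
  obtain ⟨n, hn⟩ := exists_apply_eq_one hL
  have hMn : 0 ≤ M n := by simpa using hLM (-n) (by simp [hn])
  have hker_nonpos (v : V) (hv : L v = 0) : M v ≤ 0 := by
    refine le_of_forall_pos_le_add fun ε hε ↦ ?_
    have hδ : 0 < ε / (M n + 1) := by positivity
    have hle : M v ≤ ε / (M n + 1) * M n := by
      simpa using hLM (v - (ε / (M n + 1)) • n) (by simpa [hv, hn] using hδ)
    have : ε / (M n + 1) * (M n + 1) = ε := div_mul_cancel₀ _ (by positivity)
    linarith
  have hker (v : V) (hv : L v = 0) : M v = 0 :=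
    le_antisymm (hker_nonpos v hv) (by simpa using hker_nonpos (-v) (by simp [hv]))
  have heq : M = M n • L := by
    ext v
    have := hker (v - L v • n) (by simp [hn])
    simp only [map_sub, map_smul, smul_eq_mul] at this
    simp only [LinearMap.smul_apply, smul_eq_mul]
    linarith
  exact ⟨M n, hMn.lt_of_ne fun h ↦ hM (by rw [heq, ← h, zero_smul]), heq⟩

lemma exists_fderiv_eq_smul (hf : DifferentiableAt ℝ f p) (hg : DifferentiableAt ℝ g p)
    (hf0 : f p = 0) (hg0 : g p = 0) (hfg : ∀ᶠ q in 𝓝 p, f q < 0 → g q < 0)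
    (hf' : fderiv ℝ f p ≠ 0) (hg' : fderiv ℝ g p ≠ 0) :
    ∃ h : ℝ, 0 < h ∧ fderiv ℝ g p = h • fderiv ℝ f p := by
  obtain ⟨h, hpos, heq⟩ := exists_pos_eq_smul_of_neg_imp_nonpos
    (L := (fderiv ℝ f p).toLinearMap) (M := (fderiv ℝ g p).toLinearMap)
    (fun h ↦ hf' (ContinuousLinearMap.coe_injective h))
    (fun h ↦ hg' (ContinuousLinearMap.coe_injective h))
    (fun _ hv ↦ fderiv_nonpos_of_fderiv_neg hf hg hf0 hg0 hfg hv)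
  exact ⟨h, hpos, ContinuousLinearMap.coe_injective heq⟩

lemma hessian_le_of_neg_imp_neg {h : ℝ} {n : E} (hf : ContDiffAt ℝ 2 f p)
    (hg : ContDiffAt ℝ 2 g p) (hf0 : f p = 0) (hg0 : g p = 0)
    (hfg : ∀ᶠ q in 𝓝 p, f q < 0 → g q < 0) (hfv : fderiv ℝ f p v = 0) (hgv : fderiv ℝ g p v = 0)
    (hfn : fderiv ℝ f p n = 1) (hgn : fderiv ℝ g p n = h) (hh : 0 < h) :
    fderiv ℝ (fderiv ℝ g) p v v ≤ h * fderiv ℝ (fderiv ℝ f) p v v := by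
  by_contra! hlt
  set A := fderiv ℝ (fderiv ℝ f) p v v
  set B := fderiv ℝ (fderiv ℝ g) p v v
  -- A parabola bending between the two hypersurfaces lies in `f < 0` but outside `g < 0`.
  obtain ⟨c, hcA, hcB⟩ : ∃ c : ℝ, A + 2 * c < 0 ∧ 0 < B + 2 * c * h := by
    have hAB : A < B / h := by rw [lt_div_iff₀ hh]; linarith
    have hBh : B / h * h = B := div_mul_cancel₀ _ hh.ne'
    exact ⟨-(A + B / h) / 4, by linarith, by nlinarith⟩
  have jet_f := hasTwoJetAt_quadratic_curve hf v n c
  have jet_g := hasTwoJetAt_quadratic_curve hg v n c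
  rw [hfv, hfn] at jet_f
  rw [hgv, hgn] at jet_g
  have hf_neg := (jet_f.neg.congr_jet neg_zero rfl).eventually_lt (by linarith)
  have hfg_curve := ((tendsto_quadratic_curve p v n c).eventually hfg).filter_mono
    (nhdsWithin_le_nhds (s := {0}ᶜ))
  obtain ⟨x, hfx, hgx, hx⟩ := (hf_neg.and ((jet_g.eventually_lt hcB).and hfg_curve)).exists
  simp only [zero_smul, add_zero, hf0, hg0, ne_eq, OfNat.ofNat_ne_zero, not_false_eq_true,
    zero_pow, mul_zero] at hfx hgx
  exact (hx (by linarith)).not_gt hgx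

lemma exists_hessian_eq_mul (hf : ContDiffAt ℝ 2 f p) (hg : ContDiffAt ℝ 2 g p)
    (hf0 : f p = 0) (hg0 : g p = 0) (hfg : ∀ᶠ q in 𝓝 p, f q < 0 ↔ g q < 0)
    (hf' : fderiv ℝ f p ≠ 0) (hg' : fderiv ℝ g p ≠ 0) :
    ∃ h : ℝ, 0 < h ∧ fderiv ℝ g p = h • fderiv ℝ f p ∧ ∀ v, fderiv ℝ f p v = 0 →
      fderiv ℝ (fderiv ℝ g) p v v = h * fderiv ℝ (fderiv ℝ f) p v v := by
  have himp := hfg.mono fun _ h ↦ h.1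
  have himp' := hfg.mono fun _ h ↦ h.2
  obtain ⟨h, hh, heq⟩ := exists_fderiv_eq_smul (hf.differentiableAt (by simp))
    (hg.differentiableAt (by simp)) hf0 hg0 himp hf' hg'
  refine ⟨h, hh, heq, fun v hfv ↦ le_antisymm ?_ ?_⟩
  all_goals
    obtain ⟨n, hfn⟩ := exists_apply_eq_one (L := (fderiv ℝ f p).toLinearMap)
      (fun h ↦ hf' (ContinuousLinearMap.coe_injective h))
    replace hfn : fderiv ℝ f p n = 1 := hfn
    have hgv : fderiv ℝ g p v = 0 := by simp [heq, hfv]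
  · exact hessian_le_of_neg_imp_neg hf hg hf0 hg0 himp hfv hgv hfn (by simp [heq, hfn]) hh
  · have hle := hessian_le_of_neg_imp_neg (n := h⁻¹ • n) hg hf hg0 hf0 himp' hgv hfv
      (by simp [heq, hfn, hh.ne']) (by simp [hfn]) (inv_pos.2 hh)
    rwa [inv_mul_eq_div, le_div_iff₀ hh, mul_comm] at hle

end NegativeSet

section Levi

variable {f : ℂ × ℂ → ℝ} {p t : ℂ × ℂ}

lemma fderiv_ofReal_comp {E : Type*} [NormedAddCommGroup E] [NormedSpace ℝ E] {f : E → ℝ} {p : E}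
    (hf : DifferentiableAt ℝ f p) (v : E) :
    fderiv ℝ (fun q ↦ (f q : ℂ)) p v = (fderiv ℝ f p v : ℂ) :=
  congrArg (· v) (Complex.ofRealCLM.hasFDerivAt.comp p hf.hasFDerivAt).fderiv

lemma eq_sum_e (t : ℂ × ℂ) :
    t = t.1.re • e 0 + t.1.im • (Complex.I • e 0) + t.2.re • e 1 + t.2.im • (Complex.I • e 1) := by
  ext <;> simp [e]

lemma I_smul_eq_sum_e (t : ℂ × ℂ) : Complex.I • t =
    t.1.re • (Complex.I • e 0) - t.1.im • e 0 + t.2.re • (Complex.I • e 1) - t.2.im • e 1 := by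
  ext <;> refine Complex.ext ?_ ?_ <;> simp [e]

lemma isComplexTangent_iff (hf : DifferentiableAt ℝ f p) :
    IsComplexTangent f p t ↔ fderiv ℝ f p t = 0 ∧ fderiv ℝ f p (Complex.I • t) = 0 := by
  have ht : fderiv ℝ f p t = fderiv ℝ f p _ := congrArg _ (eq_sum_e t)
  have hIt : fderiv ℝ f p (Complex.I • t) = fderiv ℝ f p _ := congrArg _ (I_smul_eq_sum_e t)
  simp only [map_add, map_sub, map_smul, smul_eq_mul] at ht hIt
  rw [IsComplexTangent, ht, hIt, Complex.ext_iff]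
  simp only [Fin.sum_univ_two, dz, fderiv_ofReal_comp hf, coord, Complex.add_re, Complex.mul_re,
    Complex.mul_im, Complex.add_im, Complex.sub_re, Complex.sub_im, Complex.div_ofNat_re,
    Complex.div_ofNat_im, Complex.ofReal_re, Complex.ofReal_im, Complex.I_re, Complex.I_im,
    Complex.zero_re, Complex.zero_im, Matrix.cons_val_zero, Matrix.cons_val_one]
  constructor <;> rintro ⟨hre, him⟩ <;> constructor <;> linarith

lemma fderiv_dzbar (hf : ContDiffAt ℝ 2 f p) (k : Fin 2) (v : ℂ × ℂ) :
    fderiv ℝ (dzbar k fun q ↦ (f q : ℂ)) p v = ((fderiv ℝ (fderiv ℝ f) p v (e k) : ℂ) +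
      Complex.I * (fderiv ℝ (fderiv ℝ f) p v (Complex.I • e k) : ℂ)) / 2 := by
  have heq : dzbar k (fun q ↦ (f q : ℂ)) =ᶠ[𝓝 p] fun q ↦
      ((fderiv ℝ f q (e k) : ℂ) + Complex.I * (fderiv ℝ f q (Complex.I • e k) : ℂ)) / 2 := by
    filter_upwards [hf.eventually (by simp)] with q hq
    simp only [dzbar, fderiv_ofReal_comp (hq.differentiableAt (by simp))]
  have hD : DifferentiableAt ℝ (fderiv ℝ f) p :=
    (hf.fderiv_right (m := 1) (by norm_num)).differentiableAt (by simp)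
  have hw (w : ℂ × ℂ) : HasFDerivAt (fun q ↦ (fderiv ℝ f q w : ℂ))
      (Complex.ofRealCLM.comp ((fderiv ℝ (fderiv ℝ f) p).flip w)) p :=
    Complex.ofRealCLM.hasFDerivAt.comp p
      ((hD.hasFDerivAt.clm_apply (hasFDerivAt_const w p)).congr_fderiv (by ext <;> simp))
  have hderiv := ((hw (e k)).add ((hw (Complex.I • e k)).const_mul Complex.I)).mul_const (2 : ℂ)⁻¹
  simp only [div_eq_mul_inv] at heq
  rw [heq.fderiv_eq]
  refine (congrArg (· v) hderiv.fderiv).trans ?_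
  simp
  ring

lemma dz_dzbar (hf : ContDiffAt ℝ 2 f p) (j k : Fin 2) :
    dz j (dzbar k (fun q ↦ (f q : ℂ))) p =
      ((fderiv ℝ (fderiv ℝ f) p (e j) (e k) +
          fderiv ℝ (fderiv ℝ f) p (Complex.I • e j) (Complex.I • e k) : ℝ) +
        Complex.I * (fderiv ℝ (fderiv ℝ f) p (e j) (Complex.I • e k) -
          fderiv ℝ (fderiv ℝ f) p (Complex.I • e j) (e k) : ℝ)) / 4 := by
  rw [dz, fderiv_dzbar hf, fderiv_dzbar hf]
  push_cast
  linear_combination (norm := ring_nf)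
    (-(fderiv ℝ (fderiv ℝ f) p (Complex.I • e j) (Complex.I • e k) : ℂ) / 4) * Complex.I_sq

lemma leviForm_eq (hf : ContDiffAt ℝ 2 f p) :
    leviForm f p t = (fderiv ℝ (fderiv ℝ f) p t t +
      fderiv ℝ (fderiv ℝ f) p (Complex.I • t) (Complex.I • t)) / 4 := by
  have ht : fderiv ℝ (fderiv ℝ f) p t t = fderiv ℝ (fderiv ℝ f) p _ _ :=
    congrArg (fun u ↦ fderiv ℝ (fderiv ℝ f) p u u) (eq_sum_e t)
  have hIt : fderiv ℝ (fderiv ℝ f) p (Complex.I • t) (Complex.I • t) =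
      fderiv ℝ (fderiv ℝ f) p _ _ :=
    congrArg (fun u ↦ fderiv ℝ (fderiv ℝ f) p u u) (I_smul_eq_sum_e t)
  simp only [map_add, map_sub, map_smul, smul_eq_mul, add_apply, sub_apply, smul_apply] at ht hIt
  rw [ht, hIt, leviForm]
  simp only [Fin.sum_univ_two, dz_dzbar hf, coord, Complex.add_re, Complex.mul_re, Complex.mul_im,
    Complex.add_im, Complex.div_ofNat_re, Complex.div_ofNat_im, Complex.ofReal_re,
    Complex.ofReal_im, Complex.I_re, Complex.I_im, Complex.conj_re, Complex.conj_im,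
    Matrix.cons_val_zero, Matrix.cons_val_one]
  ring

/- The accelerations of the two curves are opposite, as for the traces of a holomorphic disc on the
real and imaginary axes; their contributions to the second derivatives cancel. -/
lemma four_mul_leviForm_eq_of_curves {γ₁ γ₁' γ₂ γ₂' : ℝ → ℂ × ℂ} {m : ℂ × ℂ} {b₁ c₁ b₂ c₂ : ℝ}
    (hf : ContDiffAt ℝ 2 f p) (h₁ : γ₁ 0 = p) (h₂ : γ₂ 0 = p)
    (hγ₁ : ∀ x, HasDerivAt γ₁ (γ₁' x) x) (hγ₂ : ∀ x, HasDerivAt γ₂ (γ₂' x) x)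
    (hγ₁' : HasDerivAt γ₁' m 0) (hγ₂' : HasDerivAt γ₂' (-m) 0)
    (ht₁ : γ₁' 0 = t) (ht₂ : γ₂' 0 = Complex.I • t)
    (hj₁ : HasTwoJetAt (fun s ↦ f (γ₁ s)) b₁ c₁ 0)
    (hj₂ : HasTwoJetAt (fun s ↦ f (γ₂ s)) b₂ c₂ 0) :
    4 * leviForm f p t = c₁ + c₂ := by
  have e₁ := (hj₁.unique (HasTwoJetAt.comp_curve (by rwa [h₁]) hγ₁ hγ₁')).2
  have e₂ := (hj₂.unique (HasTwoJetAt.comp_curve (by rwa [h₂]) hγ₂ hγ₂')).2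
  rw [h₁, ht₁] at e₁
  rw [h₂, ht₂] at e₂
  rw [leviForm_eq hf, e₁, e₂, map_neg]
  ring

lemma four_mul_leviForm_mul {g : ℂ × ℂ → ℝ} (hf : ContDiffAt ℝ 2 f p) (hg : ContDiffAt ℝ 2 g p) :
    4 * leviForm (fun q ↦ f q * g q) p t =
      4 * leviForm f p t * g p + f p * (4 * leviForm g p t) +
        2 * (fderiv ℝ f p t * fderiv ℝ g p t +
          fderiv ℝ f p (Complex.I • t) * fderiv ℝ g p (Complex.I • t)) := by
  have hessian_mul (v : ℂ × ℂ) : fderiv ℝ (fderiv ℝ fun q ↦ f q * g q) p v v =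
      fderiv ℝ (fderiv ℝ f) p v v * g p + 2 * (fderiv ℝ f p v * fderiv ℝ g p v) +
        f p * fderiv ℝ (fderiv ℝ g) p v v := by
    simpa using ((hasTwoJetAt_line (hf.mul hg) v).unique
      ((hasTwoJetAt_line hf v).mul (hasTwoJetAt_line hg v))).2
  rw [leviForm_eq (hf.mul hg), leviForm_eq hf, leviForm_eq hg, hessian_mul, hessian_mul]
  ring

lemma four_mul_leviForm_comp {χ : ℝ → ℝ} {b c : ℝ} (hf : ContDiffAt ℝ 2 f p)
    (hχ : ContDiffAt ℝ 2 χ (f p)) (hj : HasTwoJetAt χ b c (f p)) :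
    4 * leviForm (fun q ↦ χ (f q)) p t = b * (4 * leviForm f p t) +
      c * (fderiv ℝ f p t ^ 2 + fderiv ℝ f p (Complex.I • t) ^ 2) := by
  have hc : ContDiffAt ℝ 2 (fun q ↦ χ (f q)) p := hχ.comp p hf
  have hessian_comp (v : ℂ × ℂ) : fderiv ℝ (fderiv ℝ fun q ↦ χ (f q)) p v v =
      c * fderiv ℝ f p v ^ 2 + b * fderiv ℝ (fderiv ℝ f) p v v :=
    ((hasTwoJetAt_line hc v).unique
      (HasTwoJetAt.comp (g := fun x : ℝ ↦ f (p + x • v)) (by simpa using hj)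
        (hasTwoJetAt_line hf v))).2
  rw [leviForm_eq hc, leviForm_eq hf, hessian_comp, hessian_comp]
  ring

lemma hasTwoJetAt_cos (x : ℝ) : HasTwoJetAt Real.cos (-Real.sin x) (-Real.cos x) x :=
  HasTwoJetAt.of_hasDerivAt (.of_forall Real.hasDerivAt_cos) (Real.hasDerivAt_sin x).neg

lemma hasTwoJetAt_sin (x : ℝ) : HasTwoJetAt Real.sin (Real.cos x) (-Real.sin x) x :=
  HasTwoJetAt.of_hasDerivAt (.of_forall Real.hasDerivAt_sin) (Real.hasDerivAt_cos x)

lemma hasTwoJetAt_rpow {y : ℝ} (hy : 0 < y) (τ : ℝ) :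
    HasTwoJetAt (fun y : ℝ ↦ y ^ τ) (τ * y ^ (τ - 1)) (τ * (τ - 1) * y ^ (τ - 2)) y := by
  refine HasTwoJetAt.of_hasDerivAt (g' := fun x ↦ τ * x ^ (τ - 1)) ?_ ?_
  · filter_upwards [lt_mem_nhds hy] with x hx
    exact Real.hasDerivAt_rpow_const (Or.inl hx.ne')
  · refine ((Real.hasDerivAt_rpow_const (Or.inl hy.ne')).const_mul τ).congr_deriv ?_
    ring_nf

lemma contDiffAt_neg_neg_rpow {y : ℝ} (hy : y < 0) (τ : ℝ) {n : WithTop ℕ∞} :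
    ContDiffAt ℝ n (fun y : ℝ ↦ -((-y) ^ τ)) y :=
  (contDiffAt_id.neg.rpow_const_of_ne (neg_pos.2 hy).ne').neg

/-- The form `(-f) 4 L_f + (1 - τ) |df|²`, the Levi form of `-(-f)^τ` up to a positive factor;
unlike the latter it extends across `{f = 0}`. -/
noncomputable def powerLeviForm (f : ℂ × ℂ → ℝ) (τ : ℝ) (p t : ℂ × ℂ) : ℝ :=
  -f p * (4 * leviForm f p t) +
    (1 - τ) * (fderiv ℝ f p t ^ 2 + fderiv ℝ f p (Complex.I • t) ^ 2)

lemma four_mul_leviForm_neg_neg_rpow (hf : ContDiffAt ℝ 2 f p) (hp : f p < 0) (τ : ℝ) :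
    4 * leviForm (fun q ↦ -((-f q) ^ τ)) p t =
      τ * (-f p) ^ (τ - 2) * powerLeviForm f τ p t := by
  have hjet : HasTwoJetAt (fun y : ℝ ↦ -((-y) ^ τ)) _ _ (f p) :=
    (HasTwoJetAt.comp (g := fun y ↦ -y) (hasTwoJetAt_rpow (neg_pos.2 hp) τ)
      (by simpa using HasTwoJetAt.affine 0 (-1) (f p))).neg
  have hpow : (-f p) ^ (τ - 1) = (-f p) ^ (τ - 2) * (-f p) := by
    rw [← Real.rpow_add_one (neg_pos.2 hp).ne']
    ring_nf
  rw [four_mul_leviForm_comp (χ := fun y ↦ -((-y) ^ τ)) hf (contDiffAt_neg_neg_rpow hp τ) hjet,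
    hpow, powerLeviForm]
  ring

lemma leviForm_congr {g : ℂ × ℂ → ℝ} (hf : ContDiffAt ℝ 2 f p) (h : g =ᶠ[𝓝 p] f) :
    leviForm g p t = leviForm f p t := by
  rw [leviForm_eq hf, leviForm_eq (hf.congr_of_eventuallyEq h), h.fderiv.fderiv_eq]

end Levi

namespace IsDefiningFunction

variable {Ω : Set (ℂ × ℂ)} {n : WithTop ℕ∞} {ρ ρ' : ℂ × ℂ → ℝ} {p : ℂ × ℂ}

lemma contDiffAt (hρ : IsDefiningFunction n Ω ρ) (hp : p ∈ closure Ω) : ContDiffAt ℝ n ρ p := by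
  obtain ⟨U, hU, hcl, hC, -, -⟩ := hρ
  exact hC.contDiffAt (hU.mem_nhds (hcl hp))

lemma eventually_mem_iff (hρ : IsDefiningFunction n Ω ρ) (hp : p ∈ closure Ω) :
    ∀ᶠ q in 𝓝 p, q ∈ Ω ↔ ρ q < 0 := by
  obtain ⟨U, hU, hcl, -, hΩ, -⟩ := hρ
  filter_upwards [hU.mem_nhds (hcl hp)] with q hq
  rw [hΩ]
  simp [hq]

lemma eq_zero (hρ : IsDefiningFunction n Ω ρ) (hp : p ∈ frontier Ω) : ρ p = 0 := by
  have hcl := frontier_subset_closure hp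
  have hcont := (hρ.contDiffAt hcl).continuousAt
  have hmem := hρ.eventually_mem_iff hcl
  refine le_antisymm ?_ ?_
  · by_contra! hpos
    obtain ⟨q, hq, hqΩ, hρq⟩ := (mem_closure_iff_frequently.1 hcl).and_eventually
      (hmem.and (hcont.eventually (lt_mem_nhds hpos))) |>.exists
    exact (hqΩ.1 hq).not_gt hρq
  · by_contra! hneg
    refine hp.2 (mem_interior_iff_mem_nhds.2 ?_)
    filter_upwards [hmem, hcont.eventually (gt_mem_nhds hneg)] with q hqΩ hρq
    exact hqΩ.2 hρq

lemma fderiv_ne_zero (hρ : IsDefiningFunction n Ω ρ) (hp : p ∈ frontier Ω) :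
    fderiv ℝ ρ p ≠ 0 := by
  obtain ⟨-, -, -, -, -, hd⟩ := hρ
  exact hd p hp

lemma of_le {m : WithTop ℕ∞} (hρ : IsDefiningFunction n Ω ρ) (hmn : m ≤ n) :
    IsDefiningFunction m Ω ρ := by
  obtain ⟨U, hU, hcl, hC, hΩ, hd⟩ := hρ
  exact ⟨U, hU, hcl, hC.of_le hmn, hΩ, hd⟩

lemma exists_leviForm_eq_mul (hρ : IsDefiningFunction 2 Ω ρ) (hρ' : IsDefiningFunction 2 Ω ρ')
    (hp : p ∈ frontier Ω) :
    ∃ c : ℝ, 0 < c ∧ fderiv ℝ ρ' p = c • fderiv ℝ ρ p ∧ ∀ t,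
      (IsComplexTangent ρ' p t ↔ IsComplexTangent ρ p t) ∧
      (IsComplexTangent ρ p t → leviForm ρ' p t = c * leviForm ρ p t) := by
  have hcl := frontier_subset_closure hp
  have hC := hρ.contDiffAt hcl
  have hC' := hρ'.contDiffAt hcl
  have hiff : ∀ᶠ q in 𝓝 p, ρ q < 0 ↔ ρ' q < 0 := by
    filter_upwards [hρ.eventually_mem_iff hcl, hρ'.eventually_mem_iff hcl] with q hq hq'
    rw [← hq, hq']
  obtain ⟨c, hc, hd, hH⟩ := exists_hessian_eq_mul hC hC' (hρ.eq_zero hp) (hρ'.eq_zero hp) hiff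
    (hρ.fderiv_ne_zero hp) (hρ'.fderiv_ne_zero hp)
  refine ⟨c, hc, hd, fun t ↦ ⟨?_, fun ht ↦ ?_⟩⟩
  · rw [isComplexTangent_iff (hC.differentiableAt (by simp)),
      isComplexTangent_iff (hC'.differentiableAt (by simp)), hd]
    simp [hc.ne']
  · rw [isComplexTangent_iff (hC.differentiableAt (by simp))] at ht
    rw [leviForm_eq hC, leviForm_eq hC', hH _ ht.1, hH _ ht.2]
    ring

end IsDefiningFunction

section Profile

variable {f : ℝ → ℝ} {a x : ℝ}

lemma deriv_eq_zero_of_forall_le (hf : DifferentiableAt ℝ f x) (h : ∀ y ≤ a, f y = 0)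
    (hx : x ≤ a) : deriv f x = 0 := by
  rw [← hf.derivWithin (uniqueDiffWithinAt_Iic x),
    derivWithin_congr (f := 0) (fun y hy ↦ h y (hy.trans hx)) (h x hx), derivWithin_zero]
  rfl

lemma pos_of_deriv_pos (hf : Continuous f) (ha : f a = 0) (h : ∀ y, a < y → 0 < deriv f y)
    (hx : a < x) : 0 < f x := by
  have hmono : StrictMonoOn f (Set.Ici a) :=
    strictMonoOn_of_deriv_pos (convex_Ici a) hf.continuousOn (by simpa using h)
  simpa [ha] using hmono Set.self_mem_Ici hx.le hx

/-- A smooth cut-off function for worm domains, vanishing on `(-∞, 0]` and strictly convex on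
`(0, ∞)`; the bound `one_lt` makes the domain bounded and keeps it away from `z = 0`. -/
structure IsConvexProfile (lam : ℝ → ℝ) : Prop where
  smooth : ContDiff ℝ ∞ lam
  eq_zero : ∀ x, x ≤ 0 → lam x = 0
  one_lt : ∀ x, 1 < x → 1 < lam x
  deriv_deriv_pos : ∀ x, 0 < x → 0 < deriv (deriv lam) x

variable {lam : ℝ → ℝ}

lemma IsWormProfile.isConvexProfile (hlam : IsWormProfile lam) : IsConvexProfile lam where
  smooth := hlam.smooth
  eq_zero := hlam.eq_zero
  one_lt := hlam.one_lt
  deriv_deriv_pos := hlam.deriv_deriv_pos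

namespace IsConvexProfile

lemma contDiff_deriv (hlam : IsConvexProfile lam) : ContDiff ℝ ∞ (deriv lam) :=
  (contDiff_infty_iff_deriv.1 hlam.smooth).2

lemma hasTwoJetAt (hlam : IsConvexProfile lam) (x : ℝ) :
    HasTwoJetAt lam (deriv lam x) (deriv (deriv lam) x) x :=
  .of_contDiffAt (hlam.smooth.of_le (by norm_cast)).contDiffAt

lemma deriv_eq_zero (hlam : IsConvexProfile lam) (hx : x ≤ 0) : deriv lam x = 0 :=
  deriv_eq_zero_of_forall_le (hlam.smooth.differentiable (by simp) x) hlam.eq_zero hx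

lemma deriv_deriv_eq_zero (hlam : IsConvexProfile lam) (hx : x ≤ 0) : deriv (deriv lam) x = 0 :=
  deriv_eq_zero_of_forall_le (hlam.contDiff_deriv.differentiable (by simp) x)
    (fun _ ↦ hlam.deriv_eq_zero) hx

lemma deriv_pos (hlam : IsConvexProfile lam) (hx : 0 < x) : 0 < deriv lam x :=
  pos_of_deriv_pos hlam.contDiff_deriv.continuous (hlam.deriv_eq_zero le_rfl)
    hlam.deriv_deriv_pos hx

lemma pos (hlam : IsConvexProfile lam) (hx : 0 < x) : 0 < lam x :=
  pos_of_deriv_pos hlam.smooth.continuous (hlam.eq_zero 0 le_rfl) (fun _ ↦ hlam.deriv_pos) hx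

lemma nonneg (hlam : IsConvexProfile lam) (x : ℝ) : 0 ≤ lam x :=
  (le_or_gt x 0).elim (fun h ↦ (hlam.eq_zero x h).ge) fun h ↦ (hlam.pos h).le

lemma deriv_nonneg (hlam : IsConvexProfile lam) (x : ℝ) : 0 ≤ deriv lam x :=
  (le_or_gt x 0).elim (fun h ↦ (hlam.deriv_eq_zero h).ge) fun h ↦ (hlam.deriv_pos h).le

lemma deriv_deriv_nonneg (hlam : IsConvexProfile lam) (x : ℝ) : 0 ≤ deriv (deriv lam) x :=
  (le_or_gt x 0).elim (fun h ↦ (hlam.deriv_deriv_eq_zero h).ge) fun h ↦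
    (hlam.deriv_deriv_pos x h).le

end IsConvexProfile

end Profile

section Collar

/-- The cut-off terms of the worm function, as a function of `x = log |z|`. -/
noncomputable def collar (lam : ℝ → ℝ) (r x : ℝ) : ℝ :=
  lam (Real.exp (-2 * x) - 1) + lam (Real.exp (2 * x) - r ^ 2)

variable {lam : ℝ → ℝ} {r x : ℝ}

lemma hasTwoJetAt_exp_mul_sub (k m x : ℝ) :
    HasTwoJetAt (fun x ↦ Real.exp (k * x) - m) (k * Real.exp (k * x)) (k ^ 2 * Real.exp (k * x))
      x := by
  have hexp (y : ℝ) : HasDerivAt (fun x ↦ Real.exp (k * x)) (k * Real.exp (k * y)) y :=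
    ((hasDerivAt_const_mul k).exp).congr_deriv (by ring)
  exact .of_hasDerivAt (.of_forall fun y ↦ (hexp y).sub_const m)
    (((hexp x).const_mul k).congr_deriv (by ring))

lemma hasTwoJetAt_collar (hlam : IsConvexProfile lam) (r x : ℝ) :
    HasTwoJetAt (collar lam r)
      (2 * (Real.exp (2 * x) * deriv lam (Real.exp (2 * x) - r ^ 2) -
        Real.exp (-2 * x) * deriv lam (Real.exp (-2 * x) - 1)))
      (4 * (Real.exp (-2 * x) ^ 2 * deriv (deriv lam) (Real.exp (-2 * x) - 1) +
          Real.exp (-2 * x) * deriv lam (Real.exp (-2 * x) - 1) +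
        (Real.exp (2 * x) ^ 2 * deriv (deriv lam) (Real.exp (2 * x) - r ^ 2) +
          Real.exp (2 * x) * deriv lam (Real.exp (2 * x) - r ^ 2)))) x := by
  have hinner := HasTwoJetAt.comp (hlam.hasTwoJetAt _) (hasTwoJetAt_exp_mul_sub (-2) 1 x)
  have houter := HasTwoJetAt.comp (hlam.hasTwoJetAt _) (hasTwoJetAt_exp_mul_sub 2 (r ^ 2) x)
  exact (hinner.add houter).congr_jet (by ring) (by ring)

lemma deriv_collar (hlam : IsConvexProfile lam) (r x : ℝ) :
    deriv (collar lam r) x = 2 * (Real.exp (2 * x) * deriv lam (Real.exp (2 * x) - r ^ 2) -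
      Real.exp (-2 * x) * deriv lam (Real.exp (-2 * x) - 1)) :=
  (hasTwoJetAt_collar hlam r x).hasDerivAt.deriv

lemma deriv_deriv_collar (hlam : IsConvexProfile lam) (r x : ℝ) :
    deriv (deriv (collar lam r)) x =
      4 * (Real.exp (-2 * x) ^ 2 * deriv (deriv lam) (Real.exp (-2 * x) - 1) +
          Real.exp (-2 * x) * deriv lam (Real.exp (-2 * x) - 1) +
        (Real.exp (2 * x) ^ 2 * deriv (deriv lam) (Real.exp (2 * x) - r ^ 2) +
          Real.exp (2 * x) * deriv lam (Real.exp (2 * x) - r ^ 2))) :=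
  (hasTwoJetAt_collar hlam r x).hasDerivAt_deriv.deriv

lemma contDiff_collar (hlam : IsConvexProfile lam) (r : ℝ) : ContDiff ℝ ∞ (collar lam r) :=
  (hlam.smooth.comp (by fun_prop : ContDiff ℝ ∞ fun x ↦ Real.exp (-2 * x) - 1)).add
    (hlam.smooth.comp (by fun_prop : ContDiff ℝ ∞ fun x ↦ Real.exp (2 * x) - r ^ 2))

lemma collar_nonneg (hlam : IsConvexProfile lam) (r x : ℝ) : 0 ≤ collar lam r x :=
  add_nonneg (hlam.nonneg _) (hlam.nonneg _)

lemma deriv_deriv_collar_nonneg (hlam : IsConvexProfile lam) (r x : ℝ) :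
    0 ≤ deriv (deriv (collar lam r)) x := by
  have hd := hlam.deriv_nonneg
  have hdd := hlam.deriv_deriv_nonneg
  rw [deriv_deriv_collar hlam]
  exact mul_nonneg zero_le_four (add_nonneg
    (add_nonneg (mul_nonneg (sq_nonneg _) (hdd _)) (mul_nonneg (Real.exp_pos _).le (hd _)))
    (add_nonneg (mul_nonneg (sq_nonneg _) (hdd _)) (mul_nonneg (Real.exp_pos _).le (hd _))))

lemma exp_neg_two_mul_sub_one_nonpos_iff : Real.exp (-2 * x) - 1 ≤ 0 ↔ 0 ≤ x := by
  rw [sub_nonpos, Real.exp_le_one_iff]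
  constructor <;> intro h <;> linarith

lemma exp_two_mul_sub_sq_nonpos_iff (hr : 0 < r) :
    Real.exp (2 * x) - r ^ 2 ≤ 0 ↔ x ≤ Real.log r := by
  rw [sub_nonpos, mul_comm, Real.exp_mul, Real.rpow_two,
    pow_le_pow_iff_left₀ (Real.exp_pos x).le hr.le two_ne_zero, Real.le_log_iff_exp_le hr]

lemma collar_eq_zero (hlam : IsConvexProfile lam) (hr : 0 < r) (hx : x ∈ Set.Icc 0 (Real.log r)) :
    collar lam r x = 0 := by
  rw [collar, hlam.eq_zero _ (exp_neg_two_mul_sub_one_nonpos_iff.2 hx.1),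
    hlam.eq_zero _ ((exp_two_mul_sub_sq_nonpos_iff hr).2 hx.2), add_zero]

lemma deriv_collar_eq_zero (hlam : IsConvexProfile lam) (hr : 0 < r)
    (hx : x ∈ Set.Icc 0 (Real.log r)) : deriv (collar lam r) x = 0 := by
  rw [deriv_collar hlam, hlam.deriv_eq_zero (exp_neg_two_mul_sub_one_nonpos_iff.2 hx.1),
    hlam.deriv_eq_zero ((exp_two_mul_sub_sq_nonpos_iff hr).2 hx.2)]
  ring

lemma deriv_deriv_collar_eq_zero (hlam : IsConvexProfile lam) (hr : 0 < r)
    (hx : x ∈ Set.Icc 0 (Real.log r)) : deriv (deriv (collar lam r)) x = 0 := by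
  have hinner := exp_neg_two_mul_sub_one_nonpos_iff.2 hx.1
  have houter := (exp_two_mul_sub_sq_nonpos_iff hr).2 hx.2
  rw [deriv_deriv_collar hlam, hlam.deriv_eq_zero hinner, hlam.deriv_eq_zero houter,
    hlam.deriv_deriv_eq_zero hinner, hlam.deriv_deriv_eq_zero houter]
  ring

lemma deriv_collar_ne_zero (hlam : IsConvexProfile lam) (hr : 1 ≤ r)
    (hx : x ∉ Set.Icc 0 (Real.log r)) : deriv (collar lam r) x ≠ 0 := by
  have hlog := Real.log_nonneg hr
  have hr0 : 0 < r := by linarith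
  rw [deriv_collar hlam]
  rcases lt_or_ge x 0 with hneg | hnonneg
  · have hinner : 0 < Real.exp (-2 * x) - 1 :=
      not_le.1 (exp_neg_two_mul_sub_one_nonpos_iff.not.2 hneg.not_ge)
    rw [hlam.deriv_eq_zero ((exp_two_mul_sub_sq_nonpos_iff hr0).2 (by linarith))]
    have := mul_pos (Real.exp_pos (-2 * x)) (hlam.deriv_pos hinner)
    linarith
  · have houter : 0 < Real.exp (2 * x) - r ^ 2 :=
      not_le.1 ((exp_two_mul_sub_sq_nonpos_iff hr0).not.2 fun h ↦ hx ⟨hnonneg, h⟩)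
    rw [hlam.deriv_eq_zero (exp_neg_two_mul_sub_one_nonpos_iff.2 hnonneg)]
    have := mul_pos (Real.exp_pos (2 * x)) (hlam.deriv_pos houter)
    linarith

lemma deriv_deriv_collar_pos (hlam : IsConvexProfile lam) (hr : 0 < r)
    (hx : x ∉ Set.Icc 0 (Real.log r)) : 0 < deriv (deriv (collar lam r)) x := by
  have hd := hlam.deriv_nonneg
  have hdd := hlam.deriv_deriv_nonneg
  have hterm_nonneg (e y : ℝ) (he : 0 < e) :
      0 ≤ e ^ 2 * deriv (deriv lam) y + e * deriv lam y :=
    add_nonneg (mul_nonneg (sq_nonneg _) (hdd y)) (mul_nonneg he.le (hd y))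
  have hterm_pos (e y : ℝ) (he : 0 < e) (hy : 0 < y) :
      0 < e ^ 2 * deriv (deriv lam) y + e * deriv lam y :=
    add_pos_of_pos_of_nonneg (mul_pos (pow_pos he 2) (hlam.deriv_deriv_pos y hy))
      (mul_nonneg he.le (hd y))
  rw [deriv_deriv_collar hlam]
  refine mul_pos zero_lt_four ?_
  by_cases hx0 : 0 ≤ x
  · have houter := not_le.1 ((exp_two_mul_sub_sq_nonpos_iff hr).not.2 fun h ↦ hx ⟨hx0, h⟩)
    exact add_pos_of_nonneg_of_pos (hterm_nonneg _ _ (Real.exp_pos _))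
      (hterm_pos _ _ (Real.exp_pos _) houter)
  · have hinner := not_le.1 (exp_neg_two_mul_sub_one_nonpos_iff.not.2 hx0)
    exact add_pos_of_pos_of_nonneg (hterm_pos _ _ (Real.exp_pos _) hinner)
      (hterm_nonneg _ _ (Real.exp_pos _))

end Collar

section Frame

/-- The unimodular factor `e^{i log |z|²}`: the fibre of the worm domain over `z` is a disc centred
at `-phase z`. -/
noncomputable def phase (z : ℂ) : ℂ := Complex.exp (Complex.I * (Real.log (‖z‖ ^ 2) : ℂ))

/-- The fibre coordinate `1 + w e^{-i log |z|²}`, in which the fibre of the worm domain over `z` is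
a disc centred at the origin. -/
noncomputable def fibre (p : ℂ × ℂ) : ℂ := 1 + p.2 * conj (phase p.1)

/-- The vector with components `η` and `T` in the frame `z ∂/∂z`, `e^{i log |z|²} ∂/∂w` at `p`. -/
noncomputable def frame (p : ℂ × ℂ) (η T : ℂ) : ℂ × ℂ := (p.1 * η, T * phase p.1)

/-- The restriction to the real axis of the holomorphic disc
`ζ ↦ (z e^{ηζ}, w + ζ T e^{i log |z|²})` through `p = (z, w)`. -/
noncomputable def discCurve (p : ℂ × ℂ) (η T : ℂ) (s : ℝ) : ℂ × ℂ :=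
  (p.1 * Complex.exp (η * s), p.2 + s * (T * phase p.1))

variable {f : ℂ × ℂ → ℝ} {p : ℂ × ℂ} {b c b' c' : ℝ} {n : WithTop ℕ∞}

lemma norm_phase (z : ℂ) : ‖phase z‖ = 1 := by
  rw [phase, mul_comm, Complex.norm_exp_ofReal_mul_I]

lemma phase_mul_conj (z : ℂ) : phase z * conj (phase z) = 1 := by
  rw [Complex.mul_conj, Complex.normSq_eq_norm_sq, norm_phase]
  simp

lemma phase_eq (z : ℂ) : phase z = Complex.exp (((2 * Real.log ‖z‖ : ℝ) : ℂ) * Complex.I) := by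
  rw [phase, Real.log_pow, mul_comm]
  simp

lemma norm_fibre (p : ℂ × ℂ) : ‖fibre p‖ = ‖p.2 + phase p.1‖ := by
  rw [fibre, ← phase_mul_conj p.1, ← add_mul, norm_mul, RCLike.norm_conj, norm_phase, mul_one,
    add_comm]

lemma fibre_eq_one_iff : fibre p = 1 ↔ p.2 = 0 := by
  have hphase : phase p.1 ≠ 0 := norm_ne_zero_iff.1 (by simp [norm_phase])
  simp [fibre, hphase]

lemma I_smul_frame (p : ℂ × ℂ) (η T : ℂ) :
    Complex.I • frame p η T = frame p (Complex.I * η) (Complex.I * T) := by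
  ext1 <;> simp only [frame, Prod.smul_mk, smul_eq_mul] <;> ring

lemma exists_eq_frame (hp : p.1 ≠ 0) (t : ℂ × ℂ) : ∃ η T, t = frame p η T :=
  ⟨t.1 / p.1, t.2 * conj (phase p.1), Prod.ext (mul_div_cancel₀ _ hp).symm
    (by rw [frame, mul_assoc, mul_comm (conj _), phase_mul_conj, mul_one])⟩

lemma discCurve_zero (p : ℂ × ℂ) (η T : ℂ) : discCurve p η T 0 = p := by
  simp [discCurve]

lemma hasDerivAt_discCurve (p : ℂ × ℂ) (η T : ℂ) (s : ℝ) :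
    HasDerivAt (discCurve p η T) (p.1 * (Complex.exp (η * s) * η), T * phase p.1) s := by
  have hofReal : HasDerivAt (fun s : ℝ ↦ (s : ℂ)) 1 s := Complex.ofRealCLM.hasDerivAt
  exact .prodMk (((hofReal.const_mul η).cexp.const_mul p.1).congr_deriv (by ring))
    (((hofReal.mul_const _).const_add p.2).congr_deriv (by ring))

lemma hasDerivAt_velocity_discCurve (p : ℂ × ℂ) (η T : ℂ) :
    HasDerivAt (fun s : ℝ ↦ (p.1 * (Complex.exp (η * s) * η), T * phase p.1))
      (p.1 * η ^ 2, 0) 0 := by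
  have hofReal : HasDerivAt (fun s : ℝ ↦ (s : ℂ)) 1 0 := Complex.ofRealCLM.hasDerivAt
  refine .prodMk (((hofReal.const_mul η).cexp.mul_const η).const_mul p.1 |>.congr_deriv ?_)
    (hasDerivAt_const _ _)
  simp only [Complex.ofReal_zero, mul_zero, Complex.exp_zero]
  ring

lemma fderiv_frame {η T : ℂ} (hf : ContDiffAt ℝ 2 f p)
    (hj : HasTwoJetAt (fun s ↦ f (discCurve p η T s)) b c 0) : fderiv ℝ f p (frame p η T) = b := by
  have hcurve := HasTwoJetAt.comp_curve ((discCurve_zero p η T).symm ▸ hf)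
    (hasDerivAt_discCurve p η T) (hasDerivAt_velocity_discCurve p η T)
  simpa [discCurve_zero, frame] using (hcurve.unique hj).1

lemma four_mul_leviForm_frame {η T : ℂ} (hf : ContDiffAt ℝ 2 f p)
    (hj : HasTwoJetAt (fun s ↦ f (discCurve p η T s)) b c 0)
    (hj' : HasTwoJetAt (fun s ↦ f (discCurve p (Complex.I * η) (Complex.I * T) s)) b' c' 0) :
    4 * leviForm f p (frame p η T) = c + c' := by
  refine four_mul_leviForm_eq_of_curves hf (discCurve_zero _ _ _) (discCurve_zero _ _ _)
    (hasDerivAt_discCurve p η T) (hasDerivAt_discCurve p _ _)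
    (hasDerivAt_velocity_discCurve p η T)
    ((hasDerivAt_velocity_discCurve p _ _).congr_deriv ?_) ?_ ?_ hj hj'
  · simp [mul_pow]
  · simp [frame]
  · rw [I_smul_frame]
    simp [frame]

lemma log_norm_discCurve (hp : p.1 ≠ 0) (η T : ℂ) (s : ℝ) :
    Real.log ‖(discCurve p η T s).1‖ = Real.log ‖p.1‖ + η.re * s := by
  rw [discCurve, norm_mul, Real.log_mul (by simpa using hp) (by simp), Complex.norm_exp,
    Real.log_exp, Complex.re_mul_ofReal]

lemma contDiffAt_log_norm (hp : p.1 ≠ 0) :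
    ContDiffAt ℝ n (fun q : ℂ × ℂ ↦ Real.log ‖q.1‖) p :=
  (contDiffAt_fst.norm ℝ hp).log (norm_ne_zero_iff.2 hp)

lemma contDiffAt_phase (hp : p.1 ≠ 0) : ContDiffAt ℝ n (fun q : ℂ × ℂ ↦ phase q.1) p := by
  simp only [phase_eq]
  exact ((Complex.ofRealCLM.contDiff.contDiffAt.comp p
    (contDiffAt_const.mul (contDiffAt_log_norm hp))).mul contDiffAt_const).cexp

lemma norm_fibre_discCurve (hp : p.1 ≠ 0) (η T : ℂ) (s : ℝ) :
    ‖fibre (discCurve p η T s)‖ =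
      ‖fibre p - 1 + s * T + Complex.exp ((2 * η.re * s : ℝ) * Complex.I)‖ := by
  have hphase : phase (discCurve p η T s).1 =
      phase p.1 * Complex.exp ((2 * η.re * s : ℝ) * Complex.I) := by
    rw [phase_eq, phase_eq, log_norm_discCurve hp, ← Complex.exp_add, ← add_mul]
    push_cast
    ring_nf
  have hfactor : (discCurve p η T s).2 + phase (discCurve p η T s).1 = phase p.1 *
      (fibre p - 1 + s * T + Complex.exp ((2 * η.re * s : ℝ) * Complex.I)) := by
    rw [hphase, discCurve, fibre]
    linear_combination -p.2 * phase_mul_conj p.1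
  rw [norm_fibre, hfactor, norm_mul, norm_phase, one_mul]

end Frame

section WormFunction

variable {lam : ℝ → ℝ} {r : ℝ} {p : ℂ × ℂ}

lemma wormFunction_eq (hp : p.1 ≠ 0) : wormFunction lam r p =
    Complex.normSq (fibre p) - 1 + collar lam r (Real.log ‖p.1‖) := by
  have hexp : Real.exp (2 * Real.log ‖p.1‖) = ‖p.1‖ ^ 2 := by
    rw [mul_comm, Real.exp_mul, Real.exp_log (norm_pos_iff.2 hp), Real.rpow_two]
  rw [Complex.normSq_eq_norm_sq, norm_fibre, collar, neg_mul, Real.exp_neg, hexp, wormFunction,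
    phase, one_div]
  ring

lemma contDiffAt_wormFunction (hlam : IsConvexProfile lam) (r : ℝ) (hp : p.1 ≠ 0) :
    ContDiffAt ℝ ∞ (wormFunction lam r) p := by
  have hdisc : ContDiffAt ℝ ∞ (fun q : ℂ × ℂ ↦ ‖q.2 + phase q.1‖ ^ 2 - 1) p :=
    ((contDiffAt_snd.add (contDiffAt_phase hp)).norm_sq ℝ).sub contDiffAt_const
  have hcollar : ContDiffAt ℝ ∞ (fun q : ℂ × ℂ ↦ collar lam r (Real.log ‖q.1‖)) p :=
    (contDiff_collar hlam r).contDiffAt.comp p (contDiffAt_log_norm hp)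
  refine (hdisc.add hcollar).congr_of_eventuallyEq ?_
  filter_upwards [continuous_fst.continuousAt.eventually_ne hp] with q hq
  rw [wormFunction_eq hq, Complex.normSq_eq_norm_sq, norm_fibre]

lemma contDiffAt_two_wormFunction (hlam : IsConvexProfile lam) (r : ℝ) (hp : p.1 ≠ 0) :
    ContDiffAt ℝ 2 (wormFunction lam r) p :=
  (contDiffAt_wormFunction hlam r hp).of_le (by norm_cast)

/-- The value of `∂ρ_r` on the frame vector `z ∂/∂z` is `(fibre p).im + tilt lam r p`. The tilt is
also the cross term between `∂ρ_r` and `z ∂/∂z` in the Levi form of `ρ_r`. -/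
noncomputable def tilt (lam : ℝ → ℝ) (r : ℝ) (p : ℂ × ℂ) : ℝ :=
  (fibre p).im + deriv (collar lam r) (Real.log ‖p.1‖) / 2

/-- The value of `∂ρ_r` at `p` on the vector `frame p η T`. -/
noncomputable def slope (lam : ℝ → ℝ) (r : ℝ) (p : ℂ × ℂ) (η T : ℂ) : ℂ :=
  conj (fibre p) * T + η * ((fibre p).im + tilt lam r p : ℝ)

lemma hasTwoJetAt_wormFunction (hlam : IsConvexProfile lam) (hp : p.1 ≠ 0) (η T : ℂ) :
    HasTwoJetAt (fun s ↦ wormFunction lam r (discCurve p η T s)) (2 * (slope lam r p η T).re)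
      (2 * Complex.normSq T + 8 * η.re * T.im +
        η.re ^ 2 * (deriv (deriv (collar lam r)) (Real.log ‖p.1‖) - 8 * ((fibre p).re - 1))) 0 := by
  have hangle := HasTwoJetAt.affine 0 (2 * η.re) 0
  have hcos : HasTwoJetAt Real.cos 0 (-1) (0 + 2 * η.re * 0) :=
    (hasTwoJetAt_cos _).congr_jet (by simp) (by simp)
  have hsin : HasTwoJetAt Real.sin 1 0 (0 + 2 * η.re * 0) :=
    (hasTwoJetAt_sin _).congr_jet (by simp) (by simp)
  have hre := ((HasTwoJetAt.affine ((fibre p).re - 1) T.re 0).add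
    (HasTwoJetAt.comp (g := fun s ↦ 0 + 2 * η.re * s) hcos hangle)).sq
  have him := ((HasTwoJetAt.affine (fibre p).im T.im 0).add
    (HasTwoJetAt.comp (g := fun s ↦ 0 + 2 * η.re * s) hsin hangle)).sq
  have hcollar := HasTwoJetAt.comp (g := fun s ↦ Real.log ‖p.1‖ + η.re * s)
    (HasTwoJetAt.of_contDiffAt ((contDiff_collar hlam r).of_le (by norm_cast)).contDiffAt)
    (HasTwoJetAt.affine (Real.log ‖p.1‖) η.re 0)
  refine (((hre.add him).add (HasTwoJetAt.const (-1) 0)).add hcollar).congr_of_eventuallyEq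
    (.of_forall fun s ↦ ?_) |>.congr_jet ?_ ?_
  · have hz : (discCurve p η T s).1 ≠ 0 := by simp [discCurve, hp]
    simp only [wormFunction_eq hz, log_norm_discCurve hp, Complex.normSq_eq_norm_sq,
      norm_fibre_discCurve hp]
    rw [← Complex.normSq_eq_norm_sq, Complex.normSq_apply]
    simp [Complex.exp_ofReal_mul_I_re, Complex.exp_ofReal_mul_I_im, -Complex.ofReal_mul]
    ring
  · simp [slope, tilt]
    ring
  · simp [Complex.normSq_apply]
    ring

lemma fderiv_wormFunction_frame (hlam : IsConvexProfile lam) (hp : p.1 ≠ 0) (η T : ℂ) :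
    fderiv ℝ (wormFunction lam r) p (frame p η T) = 2 * (slope lam r p η T).re :=
  fderiv_frame (contDiffAt_two_wormFunction hlam r hp) (hasTwoJetAt_wormFunction hlam hp η T)

lemma fderiv_wormFunction_I_smul_frame (hlam : IsConvexProfile lam) (hp : p.1 ≠ 0) (η T : ℂ) :
    fderiv ℝ (wormFunction lam r) p (Complex.I • frame p η T) = -2 * (slope lam r p η T).im := by
  have hslope : slope lam r p (Complex.I * η) (Complex.I * T) =
      Complex.I * slope lam r p η T := by
    rw [slope, slope]
    ring
  rw [I_smul_frame, fderiv_wormFunction_frame hlam hp, hslope, Complex.I_mul_re]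
  ring

lemma isComplexTangent_frame_iff (hlam : IsConvexProfile lam) (hp : p.1 ≠ 0) (η T : ℂ) :
    IsComplexTangent (wormFunction lam r) p (frame p η T) ↔ slope lam r p η T = 0 := by
  rw [isComplexTangent_iff
      ((contDiffAt_two_wormFunction hlam r hp).differentiableAt two_ne_zero),
    fderiv_wormFunction_frame hlam hp, fderiv_wormFunction_I_smul_frame hlam hp, Complex.ext_iff]
  simp

lemma four_mul_leviForm_wormFunction (hlam : IsConvexProfile lam) (hp : p.1 ≠ 0) (η T : ℂ) :
    4 * leviForm (wormFunction lam r) p (frame p η T) =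
      4 * Complex.normSq T + 8 * (conj η * T).im + Complex.normSq η *
        (deriv (deriv (collar lam r)) (Real.log ‖p.1‖) - 8 * ((fibre p).re - 1)) := by
  rw [four_mul_leviForm_frame (contDiffAt_two_wormFunction hlam r hp)
    (hasTwoJetAt_wormFunction hlam hp η T) (hasTwoJetAt_wormFunction hlam hp _ _)]
  simp [Complex.normSq_apply]
  ring

/-- At a boundary point `p`, the Levi form of `ρ_r` on a complex tangent vector `frame p η T`,
multiplied by `|fibre p|²`, is `|η|²` times this number. -/
noncomputable def slack (lam : ℝ → ℝ) (r : ℝ) (p : ℂ × ℂ) : ℝ :=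
  tilt lam r p ^ 2 + collar lam r (Real.log ‖p.1‖) * (fibre p).re ^ 2 +
    Complex.normSq (fibre p) *
      (((fibre p).re - 1) ^ 2 + deriv (deriv (collar lam r)) (Real.log ‖p.1‖) / 4)

lemma normSq_fibre_mul_leviForm (hlam : IsConvexProfile lam) (hp : p.1 ≠ 0) (η T : ℂ) :
    Complex.normSq (fibre p) * (4 * leviForm (wormFunction lam r) p (frame p η T)) =
      4 * Complex.normSq (slope lam r p η T) +
        8 * ((conj η * slope lam r p η T).im * (fibre p).re -
          (conj η * slope lam r p η T).re * tilt lam r p) +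
        4 * Complex.normSq η * (slack lam r p - wormFunction lam r p * (fibre p).re ^ 2) := by
  rw [four_mul_leviForm_wormFunction hlam hp, wormFunction_eq hp, slack, slope]
  simp [Complex.normSq_apply, tilt]
  ring

lemma slack_nonneg (hlam : IsConvexProfile lam) (r : ℝ) (p : ℂ × ℂ) : 0 ≤ slack lam r p := by
  have hcollar := collar_nonneg hlam r (Real.log ‖p.1‖)
  have hdd := deriv_deriv_collar_nonneg hlam r (Real.log ‖p.1‖)
  have hnormSq := Complex.normSq_nonneg (fibre p)
  rw [slack]
  positivity

end WormFunction

section Weight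

/-- The worm function multiplied by a positive weight `m (log |z|)`; these are the defining
functions used for the lower bound on the index. -/
noncomputable def weightedWorm (lam : ℝ → ℝ) (r : ℝ) (m : ℝ → ℝ) (p : ℂ × ℂ) : ℝ :=
  wormFunction lam r p * m (Real.log ‖p.1‖)

variable {lam m : ℝ → ℝ} {r : ℝ} {p : ℂ × ℂ} {n : WithTop ℕ∞}

lemma contDiffAt_weight (hm : ContDiff ℝ n m) (hp : p.1 ≠ 0) :
    ContDiffAt ℝ n (fun q : ℂ × ℂ ↦ m (Real.log ‖q.1‖)) p :=
  hm.contDiffAt.comp p (contDiffAt_log_norm hp)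

lemma hasTwoJetAt_weight (hm : ContDiff ℝ 2 m) (hp : p.1 ≠ 0) (η T : ℂ) :
    HasTwoJetAt (fun s ↦ m (Real.log ‖(discCurve p η T s).1‖))
      (η.re * deriv m (Real.log ‖p.1‖)) (η.re ^ 2 * deriv (deriv m) (Real.log ‖p.1‖)) 0 := by
  refine (HasTwoJetAt.comp (g := fun s ↦ Real.log ‖p.1‖ + η.re * s)
    (HasTwoJetAt.of_contDiffAt hm.contDiffAt)
    (HasTwoJetAt.affine (Real.log ‖p.1‖) η.re 0)).congr_of_eventuallyEq
    (.of_forall fun s ↦ by rw [log_norm_discCurve hp]) |>.congr_jet ?_ ?_ <;> simp <;> ring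

lemma fderiv_weight_frame (hm : ContDiff ℝ 2 m) (hp : p.1 ≠ 0) (η T : ℂ) :
    fderiv ℝ (fun q : ℂ × ℂ ↦ m (Real.log ‖q.1‖)) p (frame p η T) =
      η.re * deriv m (Real.log ‖p.1‖) :=
  fderiv_frame (contDiffAt_weight hm hp) (hasTwoJetAt_weight hm hp η T)

lemma four_mul_leviForm_weight (hm : ContDiff ℝ 2 m) (hp : p.1 ≠ 0) (η T : ℂ) :
    4 * leviForm (fun q : ℂ × ℂ ↦ m (Real.log ‖q.1‖)) p (frame p η T) =
      Complex.normSq η * deriv (deriv m) (Real.log ‖p.1‖) := by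
  rw [four_mul_leviForm_frame (contDiffAt_weight hm hp) (hasTwoJetAt_weight hm hp η T)
    (hasTwoJetAt_weight hm hp _ _)]
  simp [Complex.normSq_apply]
  ring

lemma contDiffAt_weightedWorm (hlam : IsConvexProfile lam) (r : ℝ) (hm : ContDiff ℝ ∞ m)
    (hp : p.1 ≠ 0) : ContDiffAt ℝ ∞ (weightedWorm lam r m) p :=
  (contDiffAt_wormFunction hlam r hp).mul (contDiffAt_weight hm hp)

lemma fderiv_weightedWorm (hlam : IsConvexProfile lam) (hm : ContDiff ℝ 2 m) (hp : p.1 ≠ 0)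
    (t : ℂ × ℂ) : fderiv ℝ (weightedWorm lam r m) p t =
      wormFunction lam r p * fderiv ℝ (fun q : ℂ × ℂ ↦ m (Real.log ‖q.1‖)) p t +
        fderiv ℝ (wormFunction lam r) p t * m (Real.log ‖p.1‖) := by
  have hworm := (contDiffAt_two_wormFunction hlam r hp).differentiableAt two_ne_zero
  have hweight := (contDiffAt_weight hm hp).differentiableAt two_ne_zero
  unfold weightedWorm
  simp only [fderiv_fun_mul hworm hweight, add_apply, smul_apply, smul_eq_mul]
  ring

lemma four_mul_leviForm_weightedWorm (hlam : IsConvexProfile lam) (hm : ContDiff ℝ 2 m)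
    (hp : p.1 ≠ 0) (η T : ℂ) :
    4 * leviForm (weightedWorm lam r m) p (frame p η T) =
      4 * leviForm (wormFunction lam r) p (frame p η T) * m (Real.log ‖p.1‖) +
        wormFunction lam r p * (Complex.normSq η * deriv (deriv m) (Real.log ‖p.1‖)) +
        4 * deriv m (Real.log ‖p.1‖) * (conj η * slope lam r p η T).re := by
  unfold weightedWorm
  rw [four_mul_leviForm_mul (contDiffAt_two_wormFunction hlam r hp) (contDiffAt_weight hm hp),
    four_mul_leviForm_weight hm hp, fderiv_weight_frame hm hp, fderiv_wormFunction_frame hlam hp,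
    fderiv_wormFunction_I_smul_frame hlam hp, I_smul_frame, fderiv_weight_frame hm hp]
  simp
  ring

end Weight

section Domain

variable {lam : ℝ → ℝ} {r : ℝ} {p : ℂ × ℂ}

/-- The annulus `M_r` of weakly pseudoconvex boundary points. -/
def annulus (r : ℝ) : Set (ℂ × ℂ) := {p | 1 ≤ ‖p.1‖ ∧ ‖p.1‖ ≤ r ∧ p.2 = 0}

lemma fst_ne_zero_of_mem_annulus (hp : p ∈ annulus r) : p.1 ≠ 0 :=
  norm_pos_iff.1 (zero_lt_one.trans_le hp.1)

lemma log_norm_mem_Icc_iff (hr : 0 < r) (hp : p.1 ≠ 0) :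
    Real.log ‖p.1‖ ∈ Set.Icc 0 (Real.log r) ↔ 1 ≤ ‖p.1‖ ∧ ‖p.1‖ ≤ r := by
  have hnorm := norm_pos_iff.2 hp
  rw [Set.mem_Icc, Real.log_nonneg_iff hnorm, Real.log_le_log_iff hnorm hr]

lemma bounds_of_mem_wormDomain (hlam : IsConvexProfile lam) (hp : p ∈ wormDomain lam r) :
    1 / 2 ≤ ‖p.1‖ ^ 2 ∧ ‖p.1‖ ^ 2 ≤ r ^ 2 + 1 ∧ ‖p.2‖ ≤ 2 := by
  obtain ⟨hz, hneg⟩ := hp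
  change ‖p.2 + phase p.1‖ ^ 2 - 1 + lam (1 / ‖p.1‖ ^ 2 - 1) + lam (‖p.1‖ ^ 2 - r ^ 2) < 0 at hneg
  have hinner := hlam.nonneg (1 / ‖p.1‖ ^ 2 - 1)
  have houter := hlam.nonneg (‖p.1‖ ^ 2 - r ^ 2)
  have hdisc := sq_nonneg ‖p.2 + phase p.1‖
  refine ⟨?_, ?_, ?_⟩
  · by_contra! hlt
    have hlarge : 2 < 1 / ‖p.1‖ ^ 2 := by
      rw [lt_div_iff₀ (by positivity)]
      linarith
    linarith [hlam.one_lt (1 / ‖p.1‖ ^ 2 - 1) (by linarith)]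
  · by_contra! hlt
    linarith [hlam.one_lt (‖p.1‖ ^ 2 - r ^ 2) (by linarith)]
  · have hle_one : ‖p.2 + phase p.1‖ ≤ 1 := by nlinarith
    have hsub := norm_sub_le (p.2 + phase p.1) (phase p.1)
    rw [add_sub_cancel_right, norm_phase] at hsub
    linarith

lemma bounds_of_mem_closure_wormDomain (hlam : IsConvexProfile lam)
    (hp : p ∈ closure (wormDomain lam r)) :
    1 / 2 ≤ ‖p.1‖ ^ 2 ∧ ‖p.1‖ ^ 2 ≤ r ^ 2 + 1 ∧ ‖p.2‖ ≤ 2 := by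
  refine closure_minimal (fun q hq ↦ bounds_of_mem_wormDomain hlam hq) ?_ hp
  exact (isClosed_le (by fun_prop) (by fun_prop)).and
    ((isClosed_le (by fun_prop) (by fun_prop)).and (isClosed_le (by fun_prop) (by fun_prop)))

lemma fst_ne_zero_of_mem_closure_wormDomain (hlam : IsConvexProfile lam)
    (hp : p ∈ closure (wormDomain lam r)) : p.1 ≠ 0 := by
  rintro hzero
  have hbound := (bounds_of_mem_closure_wormDomain hlam hp).1
  norm_num [hzero] at hbound

lemma isCompact_closure_wormDomain (hlam : IsConvexProfile lam) (r : ℝ) :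
    IsCompact (closure (wormDomain lam r)) := by
  refine Metric.isCompact_of_isClosed_isBounded isClosed_closure
    ((Metric.isBounded_closedBall (x := (0 : ℂ × ℂ)) (r := r ^ 2 + 3)).subset fun p hp ↦ ?_)
  obtain ⟨-, hfst, hsnd⟩ := bounds_of_mem_closure_wormDomain hlam hp
  rw [mem_closedBall_zero_iff, Prod.norm_def]
  exact max_le (by nlinarith [sq_nonneg (‖p.1‖ - 1)]) (by nlinarith)

lemma isOpen_wormDomain (hlam : IsConvexProfile lam) (r : ℝ) : IsOpen (wormDomain lam r) := by
  refine isOpen_iff_mem_nhds.2 fun p hp ↦ ?_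
  filter_upwards [continuous_fst.continuousAt.eventually_ne hp.1,
    (contDiffAt_wormFunction hlam r hp.1).continuousAt.eventually_lt_const hp.2] with q hq hneg
  exact ⟨hq, hneg⟩

lemma log_norm_notMem_Icc_of_fibre_eq_zero (hlam : IsConvexProfile lam) (hr : 0 < r)
    (hp : p.1 ≠ 0) (hρ : wormFunction lam r p = 0) (hF : fibre p = 0) :
    Real.log ‖p.1‖ ∉ Set.Icc 0 (Real.log r) := by
  intro hlog
  rw [wormFunction_eq hp, hF, collar_eq_zero hlam hr hlog] at hρ
  norm_num at hρ

lemma fderiv_wormFunction_ne_zero (hlam : IsConvexProfile lam) (hr : 1 ≤ r) (hp : p.1 ≠ 0)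
    (hρ : wormFunction lam r p = 0) : fderiv ℝ (wormFunction lam r) p ≠ 0 := by
  intro hzero
  have hslope (η T : ℂ) : (slope lam r p η T).re = 0 := by
    simpa [hzero] using (fderiv_wormFunction_frame (r := r) hlam hp η T).symm
  have hF : fibre p = 0 := by
    have hvertical := hslope 0 (fibre p)
    rwa [slope, zero_mul, add_zero, ← Complex.normSq_eq_conj_mul_self, Complex.ofReal_re,
      Complex.normSq_eq_zero] at hvertical
  refine deriv_collar_ne_zero hlam hr
    (log_norm_notMem_Icc_of_fibre_eq_zero hlam (by linarith) hp hρ hF) ?_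
  simpa [slope, tilt, hF] using hslope 1 0

lemma frequently_neg_of_fderiv_ne_zero {E : Type*} [NormedAddCommGroup E] [NormedSpace ℝ E]
    {f : E → ℝ} {p : E} (hf : DifferentiableAt ℝ f p) (hf0 : f p = 0) (hf' : fderiv ℝ f p ≠ 0) :
    ∃ᶠ q in 𝓝 p, f q < 0 := by
  obtain ⟨n, hn⟩ := exists_apply_eq_one (L := (fderiv ℝ f p).toLinearMap)
    fun h ↦ hf' (ContinuousLinearMap.coe_injective h)
  have hneg := eventually_pos_of_fderiv_pos (g := -f) (v := -n) hf.neg (by simpa using hf0)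
    (by simpa [fderiv_neg] using zero_lt_one.trans_eq hn.symm)
  have hline : Tendsto (fun x : ℝ ↦ p + x • -n) (𝓝[>] 0) (𝓝 p) := by
    simpa using (tendsto_quadratic_curve p (-n) 0 0).mono_left nhdsWithin_le_nhds
  exact hline.frequently (hneg.mono fun x hx ↦ by simpa using hx).frequently

lemma mem_frontier_wormDomain_iff (hlam : IsConvexProfile lam) (hr : 1 ≤ r) :
    p ∈ frontier (wormDomain lam r) ↔ p.1 ≠ 0 ∧ wormFunction lam r p = 0 := by
  rw [(isOpen_wormDomain hlam r).frontier_eq]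
  constructor
  · rintro ⟨hcl, hnot⟩
    have hz := fst_ne_zero_of_mem_closure_wormDomain hlam hcl
    refine ⟨hz, (not_lt.1 fun hneg ↦ hnot ⟨hz, hneg⟩).antisymm' ?_⟩
    by_contra! hpos
    obtain ⟨q, hq, hqpos⟩ := ((mem_closure_iff_frequently.1 hcl).and_eventually
      ((contDiffAt_wormFunction hlam r hz).continuousAt.eventually_const_lt hpos)).exists
    exact hqpos.not_gt hq.2
  · rintro ⟨hz, hρ⟩
    refine ⟨mem_closure_iff_frequently.2 ?_, fun hp ↦ hp.2.ne hρ⟩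
    exact ((frequently_neg_of_fderiv_ne_zero
      ((contDiffAt_two_wormFunction hlam r hz).differentiableAt two_ne_zero) hρ
      (fderiv_wormFunction_ne_zero hlam hr hz hρ)).and_eventually
      (continuous_fst.continuousAt.eventually_ne hz)).mono fun q hq ↦ ⟨hq.2, hq.1⟩

lemma isDefiningFunction_weightedWorm (hlam : IsConvexProfile lam) (hr : 1 ≤ r) {m : ℝ → ℝ}
    (hm : ContDiff ℝ ∞ m) (hpos : ∀ x, 0 < m x) :
    IsDefiningFunction ∞ (wormDomain lam r) (weightedWorm lam r m) := by
  refine ⟨{p | p.1 ≠ 0}, isOpen_ne.preimage continuous_fst,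
    fun p hp ↦ fst_ne_zero_of_mem_closure_wormDomain hlam hp,
    fun p hp ↦ (contDiffAt_weightedWorm hlam r hm hp).contDiffWithinAt, ?_, fun p hp hzero ↦ ?_⟩
  · ext p
    exact and_congr_right fun _ ↦ ⟨fun h ↦ mul_neg_of_neg_of_pos h (hpos _),
      fun h ↦ neg_of_mul_neg_left h (hpos _).le⟩
  · obtain ⟨hz, hρ⟩ := (mem_frontier_wormDomain_iff hlam hr).1 hp
    refine fderiv_wormFunction_ne_zero hlam hr hz hρ (ContinuousLinearMap.ext fun t ↦ ?_)
    simpa [hzero, hρ, (hpos _).ne'] using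
      (fderiv_weightedWorm (r := r) hlam (hm.of_le (by norm_cast)) hz t).symm

lemma isDefiningFunction_wormFunction (hlam : IsConvexProfile lam) (hr : 1 ≤ r) :
    IsDefiningFunction ∞ (wormDomain lam r) (wormFunction lam r) := by
  have hone : weightedWorm lam r (fun _ ↦ 1) = wormFunction lam r := funext fun _ ↦ mul_one _
  exact hone ▸ isDefiningFunction_weightedWorm hlam hr contDiff_const fun _ ↦ one_pos

end Domain

section Pseudoconvexity

variable {lam : ℝ → ℝ} {r : ℝ} {p : ℂ × ℂ} {η T : ℂ}

lemma eq_zero_of_slope_eq_zero_of_fibre_eq_zero (hlam : IsConvexProfile lam) (hr : 1 ≤ r)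
    (hp : p.1 ≠ 0) (hρ : wormFunction lam r p = 0) (hF : fibre p = 0)
    (hslope : slope lam r p η T = 0) : η = 0 := by
  simpa [slope, tilt, hF, deriv_collar_ne_zero hlam hr
    (log_norm_notMem_Icc_of_fibre_eq_zero hlam (by linarith) hp hρ hF)] using hslope

lemma leviForm_wormFunction_vertical (hlam : IsConvexProfile lam) (hp : p.1 ≠ 0) (T : ℂ) :
    leviForm (wormFunction lam r) p (frame p 0 T) = Complex.normSq T := by
  have hlevi := four_mul_leviForm_wormFunction (r := r) hlam hp 0 T
  simp only [map_zero, zero_mul, Complex.zero_im, mul_zero, add_zero] at hlevi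
  linarith

lemma normSq_fibre_mul_leviForm_of_slope_eq_zero (hlam : IsConvexProfile lam) (hp : p.1 ≠ 0)
    (hρ : wormFunction lam r p = 0) (hslope : slope lam r p η T = 0) :
    Complex.normSq (fibre p) * leviForm (wormFunction lam r) p (frame p η T) =
      Complex.normSq η * slack lam r p := by
  have hlevi := normSq_fibre_mul_leviForm (r := r) hlam hp η T
  simp only [hslope, hρ, map_zero, mul_zero, Complex.zero_im, Complex.zero_re, zero_mul,
    sub_zero, add_zero, zero_add] at hlevi
  linarith

lemma leviForm_wormFunction_nonneg (hlam : IsConvexProfile lam) (hr : 1 ≤ r) (hp : p.1 ≠ 0)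
    (hρ : wormFunction lam r p = 0) {t : ℂ × ℂ}
    (ht : IsComplexTangent (wormFunction lam r) p t) : 0 ≤ leviForm (wormFunction lam r) p t := by
  obtain ⟨η, T, rfl⟩ := exists_eq_frame hp t
  rw [isComplexTangent_frame_iff hlam hp] at ht
  rcases eq_or_ne (fibre p) 0 with hF | hF
  · rw [eq_zero_of_slope_eq_zero_of_fibre_eq_zero hlam hr hp hρ hF ht,
      leviForm_wormFunction_vertical hlam hp]
    exact Complex.normSq_nonneg T
  · refine nonneg_of_mul_nonneg_right ?_ (Complex.normSq_pos.2 hF)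
    rw [normSq_fibre_mul_leviForm_of_slope_eq_zero hlam hp hρ ht]
    exact mul_nonneg (Complex.normSq_nonneg η) (slack_nonneg hlam r p)

lemma leviForm_wormFunction_pos (hlam : IsConvexProfile lam) (hr : 1 ≤ r) (hp : p.1 ≠ 0)
    (hρ : wormFunction lam r p = 0) (hslack : fibre p ≠ 0 → 0 < slack lam r p) {t : ℂ × ℂ}
    (ht0 : t ≠ 0) (ht : IsComplexTangent (wormFunction lam r) p t) :
    0 < leviForm (wormFunction lam r) p t := by
  obtain ⟨η, T, rfl⟩ := exists_eq_frame hp t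
  have hT (hη : η = 0) : T ≠ 0 := by
    rintro rfl
    simp [frame, hη] at ht0
  rw [isComplexTangent_frame_iff hlam hp] at ht
  rcases eq_or_ne (fibre p) 0 with hF | hF
  · have hη := eq_zero_of_slope_eq_zero_of_fibre_eq_zero hlam hr hp hρ hF ht
    rw [hη, leviForm_wormFunction_vertical hlam hp]
    exact Complex.normSq_pos.2 (hT hη)
  · have hη : η ≠ 0 := fun hη ↦ hT hη (by simpa [slope, hη, hF] using ht)
    refine pos_of_mul_pos_right ?_ (Complex.normSq_nonneg (fibre p))
    rw [normSq_fibre_mul_leviForm_of_slope_eq_zero hlam hp hρ ht]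
    exact mul_pos (Complex.normSq_pos.2 hη) (hslack hF)

lemma slack_of_log_norm_mem_Icc (hlam : IsConvexProfile lam) (hr : 0 < r) (hp : p.1 ≠ 0)
    (hρ : wormFunction lam r p = 0) (hlog : Real.log ‖p.1‖ ∈ Set.Icc 0 (Real.log r)) :
    slack lam r p = Complex.normSq (fibre p - 1) := by
  rw [wormFunction_eq hp, collar_eq_zero hlam hr hlog] at hρ
  rw [slack, tilt, collar_eq_zero hlam hr hlog, deriv_collar_eq_zero hlam hr hlog,
    deriv_deriv_collar_eq_zero hlam hr hlog, Complex.normSq_apply (fibre p - 1), Complex.sub_re,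
    Complex.sub_im, Complex.one_re, Complex.one_im]
  linear_combination ((fibre p).re - 1) ^ 2 * hρ

lemma slack_pos (hlam : IsConvexProfile lam) (hr : 0 < r) (hp : p.1 ≠ 0)
    (hρ : wormFunction lam r p = 0) (hF : fibre p ≠ 0) (hM : p ∉ annulus r) :
    0 < slack lam r p := by
  by_cases hlog : Real.log ‖p.1‖ ∈ Set.Icc 0 (Real.log r)
  · have hnorm := (log_norm_mem_Icc_iff hr hp).1 hlog
    rw [slack_of_log_norm_mem_Icc hlam hr hp hρ hlog, Complex.normSq_pos, sub_ne_zero]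
    exact fun hF1 ↦ hM ⟨hnorm.1, hnorm.2, fibre_eq_one_iff.1 hF1⟩
  · have hcollar := collar_nonneg hlam r (Real.log ‖p.1‖)
    have hdd := deriv_deriv_collar_pos hlam hr hlog
    have hnormSq := Complex.normSq_pos.2 hF
    rw [slack]
    positivity

lemma fibre_of_mem_annulus (hp : p ∈ annulus r) : fibre p = 1 :=
  fibre_eq_one_iff.2 hp.2.2

lemma log_norm_mem_Icc_of_mem_annulus (hr : 0 < r) (hp : p ∈ annulus r) :
    Real.log ‖p.1‖ ∈ Set.Icc 0 (Real.log r) :=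
  (log_norm_mem_Icc_iff hr (fst_ne_zero_of_mem_annulus hp)).2 ⟨hp.1, hp.2.1⟩

lemma wormFunction_of_mem_annulus (hlam : IsConvexProfile lam) (hr : 0 < r)
    (hp : p ∈ annulus r) : wormFunction lam r p = 0 := by
  rw [wormFunction_eq (fst_ne_zero_of_mem_annulus hp), fibre_of_mem_annulus hp,
    collar_eq_zero hlam hr (log_norm_mem_Icc_of_mem_annulus hr hp)]
  simp

lemma annulus_subset_frontier_wormDomain (hlam : IsConvexProfile lam) (hr : 1 ≤ r) :
    annulus r ⊆ frontier (wormDomain lam r) := fun _ hp ↦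
  (mem_frontier_wormDomain_iff hlam hr).2
    ⟨fst_ne_zero_of_mem_annulus hp, wormFunction_of_mem_annulus hlam (by linarith) hp⟩

lemma slope_of_mem_annulus (hlam : IsConvexProfile lam) (hr : 0 < r) (hp : p ∈ annulus r)
    (η T : ℂ) : slope lam r p η T = T := by
  simp [slope, tilt, fibre_of_mem_annulus hp,
    deriv_collar_eq_zero hlam hr (log_norm_mem_Icc_of_mem_annulus hr hp)]

lemma leviForm_wormFunction_of_mem_annulus (hlam : IsConvexProfile lam) (hr : 0 < r)
    (hp : p ∈ annulus r) (η T : ℂ) : leviForm (wormFunction lam r) p (frame p η T) =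
      Complex.normSq T + 2 * (conj η * T).im := by
  have hlevi := four_mul_leviForm_wormFunction (r := r) hlam (fst_ne_zero_of_mem_annulus hp) η T
  rw [deriv_deriv_collar_eq_zero hlam hr (log_norm_mem_Icc_of_mem_annulus hr hp),
    fibre_of_mem_annulus hp] at hlevi
  simp only [Complex.one_re, sub_self, mul_zero, add_zero] at hlevi
  linarith

lemma isPseudoconvexAt_wormDomain (hlam : IsConvexProfile lam) (hr : 1 ≤ r)
    (hp : p ∈ frontier (wormDomain lam r)) : IsPseudoconvexAt (wormDomain lam r) p := by
  intro ρ hρ t ht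
  obtain ⟨hz, hzero⟩ := (mem_frontier_wormDomain_iff hlam hr).1 hp
  obtain ⟨c, hc, -, hlevi⟩ := ((isDefiningFunction_wormFunction hlam hr).of_le
    (m := 2) (by norm_cast)).exists_leviForm_eq_mul hρ hp
  have ht' := (hlevi t).1.1 ht
  rw [(hlevi t).2 ht']
  exact mul_nonneg hc.le (leviForm_wormFunction_nonneg hlam hr hz hzero ht')

lemma isPseudoconvex_wormDomain (hlam : IsConvexProfile lam) (hr : 1 ≤ r) :
    IsPseudoconvex (wormDomain lam r) :=
  ⟨⟨_, (isDefiningFunction_wormFunction hlam hr).of_le (by norm_cast)⟩,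
    fun _ hp ↦ isPseudoconvexAt_wormDomain hlam hr hp⟩

lemma isStrictlyPseudoconvexAt_wormDomain (hlam : IsConvexProfile lam) (hr : 1 ≤ r)
    (hp : p ∈ frontier (wormDomain lam r)) (hM : p ∉ annulus r) :
    IsStrictlyPseudoconvexAt (wormDomain lam r) p := by
  intro ρ hρ t ht0 ht
  obtain ⟨hz, hzero⟩ := (mem_frontier_wormDomain_iff hlam hr).1 hp
  obtain ⟨c, hc, -, hlevi⟩ := ((isDefiningFunction_wormFunction hlam hr).of_le
    (m := 2) (by norm_cast)).exists_leviForm_eq_mul hρ hp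
  have ht' := (hlevi t).1.1 ht
  rw [(hlevi t).2 ht']
  exact mul_pos hc (leviForm_wormFunction_pos hlam hr hz hzero
    (fun hF ↦ slack_pos hlam (by linarith) hz hzero hF hM) ht0 ht')

lemma not_isStrictlyPseudoconvexAt_of_mem_annulus (hlam : IsConvexProfile lam) (hr : 1 ≤ r)
    (hp : p ∈ annulus r) : ¬ IsStrictlyPseudoconvexAt (wormDomain lam r) p := by
  intro hstrict
  have hr0 : 0 < r := by linarith
  have hz := fst_ne_zero_of_mem_annulus hp
  have hpos := hstrict _ ((isDefiningFunction_wormFunction hlam hr).of_le (by norm_cast))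
    (frame p 1 0) (by simpa [frame] using hz)
    ((isComplexTangent_frame_iff hlam hz 1 0).2 (slope_of_mem_annulus hlam hr0 hp 1 0))
  rw [leviForm_wormFunction_of_mem_annulus hlam hr0 hp] at hpos
  simp at hpos

lemma weaklyPseudoconvexPoints_wormDomain (hlam : IsConvexProfile lam) (hr : 1 ≤ r) :
    weaklyPseudoconvexPoints (wormDomain lam r) = annulus r := by
  ext p
  constructor
  · rintro ⟨hp, -, hnot⟩
    by_contra hM
    exact hnot (isStrictlyPseudoconvexAt_wormDomain hlam hr hp hM)
  · intro hp
    have hfr := annulus_subset_frontier_wormDomain hlam hr hp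
    exact ⟨hfr, isPseudoconvexAt_wormDomain hlam hr hfr,
      not_isStrictlyPseudoconvexAt_of_mem_annulus hlam hr hp⟩

end Pseudoconvexity

section Truncation

variable {a x : ℝ}

/-- A smooth convex nondecreasing function which is the identity on `[-a, ∞)` and constant on
`(-∞, -2 * a]`. -/
noncomputable def truncation (a x : ℝ) : ℝ :=
  ∫ y in (0 : ℝ)..x, Real.smoothTransition ((y + 2 * a) / a)

lemma contDiff_smoothTransition_affine (a : ℝ) :
    ContDiff ℝ ∞ fun y ↦ Real.smoothTransition ((y + 2 * a) / a) :=
  Real.smoothTransition.contDiff.comp ((contDiff_id.add contDiff_const).div_const a)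

lemma hasDerivAt_truncation (a x : ℝ) :
    HasDerivAt (truncation a) (Real.smoothTransition ((x + 2 * a) / a)) x :=
  have hcont := (contDiff_smoothTransition_affine a).continuous
  intervalIntegral.integral_hasDerivAt_right (hcont.intervalIntegrable _ _)
    (hcont.stronglyMeasurableAtFilter _ _) hcont.continuousAt

lemma deriv_truncation (a : ℝ) :
    deriv (truncation a) = fun x ↦ Real.smoothTransition ((x + 2 * a) / a) :=
  funext fun x ↦ (hasDerivAt_truncation a x).deriv

lemma contDiff_truncation (a : ℝ) : ContDiff ℝ ∞ (truncation a) :=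
  contDiff_infty_iff_deriv.2 ⟨fun x ↦ (hasDerivAt_truncation a x).differentiableAt,
    deriv_truncation a ▸ contDiff_smoothTransition_affine a⟩

lemma deriv_truncation_nonneg (a x : ℝ) : 0 ≤ deriv (truncation a) x := by
  rw [deriv_truncation]
  exact Real.smoothTransition.nonneg _

lemma deriv_deriv_truncation_nonneg (ha : 0 < a) (x : ℝ) : 0 ≤ deriv (deriv (truncation a)) x := by
  rw [deriv_truncation]
  refine Monotone.deriv_nonneg fun x y hxy ↦ Real.smoothTransition.monotone ?_
  gcongr

lemma truncation_eq_self (ha : 0 < a) (hx : -a ≤ x) : truncation a x = x := by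
  have hone : Set.EqOn (fun y ↦ Real.smoothTransition ((y + 2 * a) / a)) (fun _ ↦ 1)
      (Set.uIcc 0 x) := fun y hy ↦ by
    have hy : -a ≤ y := (le_min (by linarith) hx).trans hy.1
    exact Real.smoothTransition.one_of_one_le (by rw [le_div_iff₀ ha]; linarith)
  simp [truncation, intervalIntegral.integral_congr hone]

lemma truncation_neg (ha : 0 < a) (hx : x < 0) : truncation a x < 0 := by
  rcases le_total (-a) x with h | h
  · rwa [truncation_eq_self ha h]
  · have hmono := monotone_of_deriv_nonneg
      (fun y ↦ (hasDerivAt_truncation a y).differentiableAt) (deriv_truncation_nonneg a) h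
    rw [truncation_eq_self ha le_rfl] at hmono
    linarith

lemma deriv_truncation_eq_zero (ha : 0 < a) (hx : x ≤ -2 * a) : deriv (truncation a) x = 0 := by
  rw [deriv_truncation]
  exact Real.smoothTransition.zero_of_nonpos (div_nonpos_of_nonpos_of_nonneg (by linarith) ha.le)

lemma deriv_deriv_truncation_eq_zero (ha : 0 < a) (hx : x ≤ -2 * a) :
    deriv (deriv (truncation a)) x = 0 := by
  refine IsLocalMin.deriv_eq_zero (Eventually.of_forall fun y ↦ ?_)
  rw [deriv_truncation_eq_zero ha hx]
  exact deriv_truncation_nonneg a y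

end Truncation

section Flatten

variable {τ a x : ℝ}

/-- The function `φ` with `-(-φ x)^τ = truncation a (-(-x)^τ)` for `x < 0`, continued by the
identity. -/
noncomputable def flatten (τ a x : ℝ) : ℝ :=
  if x < 0 then -((-truncation a (-((-x) ^ τ))) ^ τ⁻¹) else x

lemma neg_neg_rpow_neg (hx : x < 0) (τ : ℝ) : -((-x) ^ τ) < 0 :=
  neg_neg_of_pos (Real.rpow_pos_of_pos (neg_pos.2 hx) τ)

lemma flatten_neg_iff (ha : 0 < a) : flatten τ a x < 0 ↔ x < 0 := by
  by_cases hx : x < 0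
  · simp only [flatten, hx, if_true, iff_true]
    exact neg_neg_rpow_neg (truncation_neg ha (neg_neg_rpow_neg hx τ)) τ⁻¹
  · simp [flatten, hx]

lemma neg_neg_flatten_rpow (ha : 0 < a) (hτ : τ ≠ 0) (hx : x < 0) :
    -((-flatten τ a x) ^ τ) = truncation a (-((-x) ^ τ)) := by
  have hneg := truncation_neg ha (neg_neg_rpow_neg hx τ)
  rw [flatten, if_pos hx, neg_neg, Real.rpow_inv_rpow (by linarith) hτ, neg_neg]

lemma flatten_eq_self (ha : 0 < a) (hτ : 0 < τ) (hx : -a ^ τ⁻¹ < x) : flatten τ a x = x := by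
  by_cases hx0 : x < 0
  · have hle : (-x) ^ τ ≤ (a ^ τ⁻¹) ^ τ := Real.rpow_le_rpow (by linarith) (by linarith) hτ.le
    rw [Real.rpow_inv_rpow ha.le hτ.ne'] at hle
    rw [flatten, if_pos hx0, truncation_eq_self ha (by linarith), neg_neg,
      Real.rpow_rpow_inv (by linarith) hτ.ne', neg_neg]
  · rw [flatten, if_neg hx0]

lemma flatten_eventuallyEq_id (ha : 0 < a) (hτ : 0 < τ) (hx : -a ^ τ⁻¹ < x) :
    flatten τ a =ᶠ[𝓝 x] id :=
  (lt_mem_nhds hx).mono fun _ hy ↦ flatten_eq_self ha hτ hy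

lemma contDiff_flatten (ha : 0 < a) (hτ : 0 < τ) : ContDiff ℝ ∞ (flatten τ a) := by
  refine contDiff_iff_contDiffAt.2 fun x ↦ ?_
  rcases lt_or_ge (-a ^ τ⁻¹) x with hx | hx
  · exact contDiffAt_id.congr_of_eventuallyEq (flatten_eventuallyEq_id ha hτ hx)
  · have hx0 : x < 0 := hx.trans_lt (neg_neg_of_pos (Real.rpow_pos_of_pos ha _))
    have hneg := truncation_neg ha (neg_neg_rpow_neg hx0 τ)
    have hsmooth : ContDiffAt ℝ ∞ (fun y ↦ -((-truncation a (-((-y) ^ τ))) ^ τ⁻¹)) x :=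
      ContDiffAt.comp (g := fun y ↦ -((-y) ^ τ⁻¹)) (f := fun y ↦ truncation a (-((-y) ^ τ))) x
        (contDiffAt_neg_neg_rpow hneg τ⁻¹)
        ((contDiff_truncation a).contDiffAt.comp x (contDiffAt_neg_neg_rpow hx0 τ))
    refine hsmooth.congr_of_eventuallyEq ?_
    filter_upwards [gt_mem_nhds hx0] with y hy
    exact if_pos hy

lemma deriv_flatten_zero (ha : 0 < a) (hτ : 0 < τ) : deriv (flatten τ a) 0 = 1 := by
  rw [(flatten_eventuallyEq_id ha hτ (neg_neg_of_pos (Real.rpow_pos_of_pos ha _))).deriv_eq,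
    deriv_id]

variable {f : ℂ × ℂ → ℝ} {p t : ℂ × ℂ}

lemma neg_neg_flatten_rpow_eventuallyEq (ha : 0 < a) (hτ : τ ≠ 0) (hf : ContinuousAt f p)
    (hp : f p < 0) : (fun q ↦ -((-flatten τ a (f q)) ^ τ)) =ᶠ[𝓝 p]
      fun q ↦ truncation a (-((-f q) ^ τ)) :=
  (hf.eventually (gt_mem_nhds hp)).mono fun _ hq ↦ neg_neg_flatten_rpow ha hτ hq

lemma contDiffAt_neg_neg_flatten_rpow {n : WithTop ℕ∞} (hn : n ≤ ∞) (ha : 0 < a) (hτ : τ ≠ 0)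
    (hf : ContDiffAt ℝ n f p) (hp : f p < 0) :
    ContDiffAt ℝ n (fun q ↦ -((-flatten τ a (f q)) ^ τ)) p :=
  (((contDiff_truncation a).of_le hn).contDiffAt.comp p
    ((contDiffAt_neg_neg_rpow hp τ).comp p hf)).congr_of_eventuallyEq
      (neg_neg_flatten_rpow_eventuallyEq ha hτ hf.continuousAt hp)

lemma leviForm_neg_neg_flatten_rpow_nonneg (ha : 0 < a) (hτ : 0 < τ) (hf : ContDiffAt ℝ 2 f p)
    (hp : f p < 0) (h : (-f p) ^ τ < 2 * a → 0 ≤ powerLeviForm f τ p t) :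
    0 ≤ leviForm (fun q ↦ -((-flatten τ a (f q)) ^ τ)) p t := by
  have hu : ContDiffAt ℝ 2 (fun q ↦ -((-f q) ^ τ)) p := (contDiffAt_neg_neg_rpow hp τ).comp p hf
  have hχ : ContDiff ℝ 2 (truncation a) := (contDiff_truncation a).of_le (by norm_cast)
  rw [leviForm_congr (f := fun q ↦ truncation a (-((-f q) ^ τ))) (hχ.contDiffAt.comp p hu)
    (neg_neg_flatten_rpow_eventuallyEq ha hτ.ne' hf.continuousAt hp)]
  have hcomp := four_mul_leviForm_comp (t := t) hu hχ.contDiffAt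
    (HasTwoJetAt.of_contDiffAt hχ.contDiffAt)
  suffices 0 ≤ 4 * leviForm (fun q ↦ truncation a (-((-f q) ^ τ))) p t by linarith
  rw [hcomp]
  rcases lt_or_ge ((-f p) ^ τ) (2 * a) with hlt | hge
  · have hlevi : 0 ≤ 4 * leviForm (fun q ↦ -((-f q) ^ τ)) p t := by
      rw [four_mul_leviForm_neg_neg_rpow hf hp]
      have := Real.rpow_nonneg (neg_nonneg.2 hp.le) (τ - 2)
      have := h hlt
      positivity
    have := deriv_truncation_nonneg a (-((-f p) ^ τ))
    have := deriv_deriv_truncation_nonneg ha (-((-f p) ^ τ))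
    positivity
  · rw [deriv_truncation_eq_zero ha (by linarith), deriv_deriv_truncation_eq_zero ha (by linarith)]
    simp

end Flatten

section Exponent

lemma exists_pos_forall_of_eventually_frontier {X : Type*} [TopologicalSpace X] {Ω : Set X}
    {f : X → ℝ} {P : X → Prop} (hΩ : IsOpen Ω) (hcpt : IsCompact (closure Ω))
    (hf : ContinuousOn f (closure Ω)) (hneg : ∀ p ∈ Ω, f p < 0)
    (h : ∀ q ∈ frontier Ω, ∀ᶠ p in 𝓝 q, p ∈ Ω → P p) :
    ∃ ε > 0, ∀ p ∈ Ω, -ε < f p → P p := by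
  set N := {q | ∀ᶠ p in 𝓝 q, p ∈ Ω → P p}
  have hK : IsCompact (closure Ω \ N) := hcpt.diff isOpen_setOfPred_eventually_nhds
  have hKΩ : closure Ω \ N ⊆ Ω := fun q hq ↦ by
    by_contra hqΩ
    exact hq.2 (h q (hΩ.frontier_eq ▸ ⟨hq.1, hqΩ⟩))
  have hgood : ∀ p ∈ Ω, p ∉ closure Ω \ N → P p := fun p hp hpK ↦
    (not_not.1 fun hpN ↦ hpK ⟨subset_closure hp, hpN⟩ : p ∈ N).self_of_nhds hp
  rcases (closure Ω \ N).eq_empty_or_nonempty with hempty | hne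
  · exact ⟨1, one_pos, fun p hp _ ↦ hgood p hp (by simp [hempty])⟩
  · obtain ⟨q, hq, hmax⟩ := hK.exists_isMaxOn hne (hf.mono Set.sdiff_subset)
    exact ⟨-f q, neg_pos.2 (hneg q (hKΩ hq)), fun p hp hlt ↦ hgood p hp fun hpK ↦
      absurd (hmax hpK) (by simpa using hlt)⟩

variable {f : ℂ × ℂ → ℝ} {τ : ℝ} {Ω : Set (ℂ × ℂ)} {p t : ℂ × ℂ} {n : WithTop ℕ∞}

lemma IsDefiningFunction.apply_neg (hf : IsDefiningFunction n Ω f) (hp : p ∈ Ω) : f p < 0 :=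
  (hf.eventually_mem_iff (subset_closure hp)).self_of_nhds.1 hp

lemma IsDefiningFunction.comp_left {φ : ℝ → ℝ} (hf : IsDefiningFunction n Ω f) (hn : n ≠ 0)
    (hφ : ContDiff ℝ n φ) (hneg : ∀ x, φ x < 0 ↔ x < 0) (hderiv : deriv φ 0 ≠ 0) :
    IsDefiningFunction n Ω (fun p ↦ φ (f p)) := by
  obtain ⟨U, hU, hcl, hC, hΩ, hd⟩ := id hf
  refine ⟨U, hU, hcl, hφ.comp_contDiffOn hC, by simpa only [hneg] using hΩ, fun p hp ↦ ?_⟩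
  have hfp := (hf.contDiffAt (frontier_subset_closure hp)).differentiableAt hn
  have hφ0 : HasDerivAt φ (deriv φ 0) (f p) := by
    rw [hf.eq_zero hp]
    exact (hφ.differentiable hn 0).hasDerivAt
  have hcomp : HasFDerivAt (fun q ↦ φ (f q)) (deriv φ 0 • fderiv ℝ f p) p :=
    hφ0.comp_hasFDerivAt p hfp.hasFDerivAt
  rw [hcomp.fderiv]
  exact smul_ne_zero hderiv (hd p hp)

lemma isDFExponent_of_eventually (hΩ : IsOpen Ω) (hcpt : IsCompact (closure Ω)) (hτ0 : 0 < τ)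
    (hτ1 : τ < 1) (hf : IsDefiningFunction ∞ Ω f)
    (h : ∀ q ∈ frontier Ω, ∀ᶠ p in 𝓝 q, p ∈ Ω → ∀ t, 0 ≤ powerLeviForm f τ p t) :
    IsDFExponent Ω τ := by
  obtain ⟨ε, hε, hnear⟩ := exists_pos_forall_of_eventually_frontier hΩ hcpt
    (fun p hp ↦ (hf.contDiffAt hp).continuousAt.continuousWithinAt) (fun _ ↦ hf.apply_neg) h
  have hετ : 0 < ε ^ τ := Real.rpow_pos_of_pos hε τ
  set a := ε ^ τ / 2 with ha_def
  have ha : 0 < a := half_pos hετ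
  have hfC : ∀ p ∈ Ω, ContDiffAt ℝ 2 f p := fun p hp ↦
    (hf.contDiffAt (subset_closure hp)).of_le (by norm_cast)
  refine ⟨hτ0, hτ1, fun p ↦ flatten τ a (f p),
    hf.comp_left (by simp) (contDiff_flatten ha hτ0) (fun _ ↦ flatten_neg_iff ha)
      (by simp [deriv_flatten_zero ha hτ0]),
    fun p hp ↦ (contDiffAt_neg_neg_flatten_rpow (by norm_cast) ha hτ0.ne' (hfC p hp)
      (hf.apply_neg hp)).contDiffWithinAt, fun p hp t ↦ ?_⟩
  refine leviForm_neg_neg_flatten_rpow_nonneg ha hτ0 (hfC p hp) (hf.apply_neg hp) fun hlt ↦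
    hnear p hp ?_ t
  rw [ha_def, mul_div_cancel₀ _ two_ne_zero] at hlt
  linarith [(Real.rpow_lt_rpow_iff (neg_nonneg.2 (hf.apply_neg hp).le) hε.le hτ0).1 hlt]

end Exponent

section StrictlyPseudoconvex

variable {f : ℂ × ℂ → ℝ} {τ : ℝ} {p q t : ℂ × ℂ}

lemma powerLeviForm_smul (hf : ContDiffAt ℝ 2 f p) (c : ℝ) :
    powerLeviForm f τ p (c • t) = c ^ 2 * powerLeviForm f τ p t := by
  rw [powerLeviForm, powerLeviForm, leviForm_eq hf, leviForm_eq hf, smul_comm Complex.I]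
  simp only [map_smul, smul_apply, smul_eq_mul]
  ring

lemma continuousAt_fderiv_apply (hf : ContDiffAt ℝ 1 f p) (c : ℂ) :
    ContinuousAt (fun z : (ℂ × ℂ) × (ℂ × ℂ) ↦ fderiv ℝ f z.1 (c • z.2)) (p, t) :=
  (ContinuousAt.comp (g := fderiv ℝ f) (f := Prod.fst) (x := (p, t))
    (hf.fderiv_right (m := 0) (by simp)).continuousAt continuousAt_fst).clm_apply
      (continuousAt_snd.const_smul c)

lemma continuousAt_leviForm (hf : ContDiffAt ℝ 2 f p) :
    ContinuousAt (fun z : (ℂ × ℂ) × (ℂ × ℂ) ↦ leviForm f z.1 z.2) (p, t) := by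
  have hhess : ContinuousAt (fun z : (ℂ × ℂ) × (ℂ × ℂ) ↦ fderiv ℝ (fderiv ℝ f) z.1) (p, t) :=
    ContinuousAt.comp (g := fderiv ℝ (fderiv ℝ f)) (f := Prod.fst) (x := (p, t))
      ((hf.fderiv_right (m := 1) (by norm_num)).fderiv_right (m := 0) (by simp)).continuousAt
      continuousAt_fst
  have hquad : ∀ c : ℂ, ContinuousAt (fun z : (ℂ × ℂ) × (ℂ × ℂ) ↦
      fderiv ℝ (fderiv ℝ f) z.1 (c • z.2) (c • z.2)) (p, t) := fun c ↦
    (hhess.clm_apply (continuousAt_snd.const_smul c)).clm_apply (continuousAt_snd.const_smul c)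
  refine (((hquad 1).add (hquad Complex.I)).div_const 4).congr ?_
  filter_upwards [(continuousAt_fst (p := (p, t))).eventually (hf.eventually (by simp))] with z hz
  simp only [leviForm_eq hz, one_smul, Pi.add_apply]

lemma continuousAt_powerLeviForm (hf : ContDiffAt ℝ 2 f p) :
    ContinuousAt (fun z : (ℂ × ℂ) × (ℂ × ℂ) ↦ powerLeviForm f τ z.1 z.2) (p, t) := by
  have hfst : ContinuousAt (fun z : (ℂ × ℂ) × (ℂ × ℂ) ↦ f z.1) (p, t) :=
    ContinuousAt.comp (f := Prod.fst) (x := (p, t)) hf.continuousAt continuousAt_fst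
  have hderiv := continuousAt_fderiv_apply (t := t) (hf.of_le one_le_two)
  have hone := hderiv 1
  simp only [one_smul] at hone
  exact (hfst.neg.mul ((continuousAt_leviForm hf).const_mul 4)).add
    (((hone.pow 2).add ((hderiv Complex.I).pow 2)).const_mul (1 - τ))

lemma eventually_powerLeviForm_nonneg_prod (hτ : τ < 1) (hf : ContDiffAt ℝ 2 f q) (h0 : f q = 0)
    (hpos : IsComplexTangent f q t → 0 < leviForm f q t) :
    ∀ᶠ z : (ℂ × ℂ) × (ℂ × ℂ) in 𝓝 (q, t), f z.1 < 0 → 0 ≤ powerLeviForm f τ z.1 z.2 := by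
  by_cases htan : IsComplexTangent f q t
  · filter_upwards [(continuousAt_leviForm hf).eventually (lt_mem_nhds (hpos htan))] with z hz hneg
    have := sub_pos.2 hτ
    have := neg_pos.2 hneg
    rw [powerLeviForm]
    positivity
  · have hlt : 0 < powerLeviForm f τ q t := by
      rw [isComplexTangent_iff (hf.differentiableAt (by simp))] at htan
      rw [powerLeviForm, h0, neg_zero, zero_mul, zero_add]
      refine mul_pos (sub_pos.2 hτ) (lt_of_le_of_ne (by positivity) fun hzero ↦ htan ?_)
      simpa using (add_eq_zero_iff_of_nonneg (sq_nonneg _) (sq_nonneg _)).1 hzero.symm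
    filter_upwards [(continuousAt_powerLeviForm hf).eventually (lt_mem_nhds hlt)] with z hz _
    exact hz.le

lemma eventually_powerLeviForm_nonneg (hτ : τ < 1) (hf : ContDiffAt ℝ 2 f q) (h0 : f q = 0)
    (hpos : ∀ t, t ≠ 0 → IsComplexTangent f q t → 0 < leviForm f q t) :
    ∀ᶠ p in 𝓝 q, f p < 0 → ∀ t, 0 ≤ powerLeviForm f τ p t := by
  have hsphere : ∀ᶠ p in 𝓝 q, ∀ t ∈ Metric.sphere (0 : ℂ × ℂ) 1,
      f p < 0 → 0 ≤ powerLeviForm f τ p t :=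
    (isCompact_sphere _ _).eventually_forall_of_forall_eventually fun t ht ↦
      eventually_powerLeviForm_nonneg_prod hτ hf h0
        (hpos t (Metric.ne_of_mem_sphere ht one_ne_zero))
  filter_upwards [hsphere, hf.eventually (by simp)] with p hp hfp hneg t
  rcases eq_or_ne t 0 with rfl | ht
  · simpa using (powerLeviForm_smul (τ := τ) (t := 0) hfp 0).ge
  · have hnorm : ‖t‖ ≠ 0 := norm_ne_zero_iff.2 ht
    have hunit := hp (‖t‖⁻¹ • t) (by simp [norm_smul, hnorm]) hneg
    rw [powerLeviForm_smul hfp] at hunit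
    exact nonneg_of_mul_nonneg_right hunit (by positivity)

end StrictlyPseudoconvex

section Riccati

variable {τ k l c x : ℝ}

/-- The gap in the Riccati inequality for `(log m)'` to which plurisubharmonicity of
`-(-(m (log |z|) ρ_r))^τ` reduces on the annulus `M_r`. -/
noncomputable def riccatiDefect (τ : ℝ) (m : ℝ → ℝ) (x : ℝ) : ℝ :=
  (1 - τ) * (1 - (deriv (deriv m) x / m x - (1 - τ) * (deriv m x / m x) ^ 2) / 4) -
    ((τ * (deriv m x / m x) / 2) ^ 2 + 1)

lemma riccatiDefect_congr {m g : ℝ → ℝ} (h : m =ᶠ[𝓝 x] g) :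
    riccatiDefect τ m x = riccatiDefect τ g x := by
  rw [riccatiDefect, riccatiDefect, h.deriv.deriv_eq, h.deriv_eq, h.eq_of_nhds]

lemma riccatiDefect_cos_rpow (hτ : τ ≠ 0) (hcos : 0 < Real.cos (2 * k * (x - c))) :
    riccatiDefect τ (fun y ↦ Real.cos (2 * k * (y - c)) ^ ((1 - τ) / τ)) x =
      ((1 - τ) ^ 2 * k ^ 2 - τ ^ 2) / τ := by
  have hangle : HasTwoJetAt (fun y ↦ 2 * k * (y - c)) (2 * k) 0 x :=
    (HasTwoJetAt.affine (-(2 * k * c)) (2 * k) x).congr_of_eventuallyEq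
      (.of_forall fun y ↦ by ring)
  have hjet := HasTwoJetAt.comp (g := fun y ↦ Real.cos (2 * k * (y - c)))
    (hasTwoJetAt_rpow hcos ((1 - τ) / τ))
    (HasTwoJetAt.comp (g := fun y ↦ 2 * k * (y - c)) (hasTwoJetAt_cos _) hangle)
  rw [riccatiDefect, hjet.hasDerivAt.deriv, hjet.hasDerivAt_deriv.deriv,
    Real.rpow_sub_one hcos.ne', Real.rpow_sub hcos, Real.rpow_two]
  have hpow := Real.rpow_pos_of_pos hcos ((1 - τ) / τ)
  generalize Real.cos (2 * k * (x - c)) ^ ((1 - τ) / τ) = P at *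
  generalize Real.cos (2 * k * (x - c)) = S at *
  field_simp
  ring

lemma exists_contDiff_pos_eventuallyEq {g : ℝ → ℝ} {ρ R : ℝ} (hρ : 0 ≤ ρ) (hρR : ρ < R)
    (hg : ∀ x ∈ Metric.ball c R, ContDiffAt ℝ ∞ g x ∧ 0 < g x) :
    ∃ m : ℝ → ℝ, ContDiff ℝ ∞ m ∧ (∀ x, 0 < m x) ∧ ∀ x ∈ Metric.closedBall c ρ, m =ᶠ[𝓝 x] g := by
  let f : ContDiffBump c := ⟨(2 * ρ + R) / 3, (ρ + 2 * R) / 3, by linarith, by linarith⟩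
  have hball_or_zero : ∀ x, x ∈ Metric.ball c R ∨ f =ᶠ[𝓝 x] 0 := fun x ↦ by
    refine or_iff_not_imp_left.2 fun hx ↦ notMem_tsupport_iff_eventuallyEq.1 fun hsupp ↦ hx ?_
    rw [f.tsupport_eq] at hsupp
    exact Metric.closedBall_subset_ball (by change (ρ + 2 * R) / 3 < R; linarith) hsupp
  have hfC : ContDiff ℝ ∞ f := f.contDiff
  refine ⟨fun x ↦ f x * g x + (1 - f x), contDiff_iff_contDiffAt.2 fun x ↦ ?_, fun x ↦ ?_,
    fun x hx ↦ ?_⟩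
  · rcases hball_or_zero x with hx | hx
    · exact (hfC.contDiffAt.mul (hg x hx).1).add (contDiffAt_const.sub hfC.contDiffAt)
    · refine (contDiffAt_const (c := (1 : ℝ))).congr_of_eventuallyEq ?_
      filter_upwards [hx] with y hy
      simp [hy]
  · rcases hball_or_zero x with hx | hx
    · have hgx := (hg x hx).2
      rcases (f.le_one (x := x)).lt_or_eq with h1 | h1
      · have := mul_nonneg (f.nonneg (x := x)) hgx.le
        linarith
      · simpa [h1] using hgx
    · simp [hx.eq_of_nhds]
  · filter_upwards [f.eventuallyEq_one_of_mem_ball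
      (Metric.closedBall_subset_ball (by change ρ < (2 * ρ + R) / 3; linarith) hx)] with y hy
    simp [hy]

lemma exists_weight (hτ0 : 0 < τ) (hτ1 : τ < 1) (hk : τ / (1 - τ) < k) (hl : 0 ≤ l)
    (hkl : 2 * k * l < Real.pi) :
    ∃ m : ℝ → ℝ, ContDiff ℝ ∞ m ∧ (∀ x, 0 < m x) ∧
      ∀ x ∈ Set.Icc 0 l, 0 < riccatiDefect τ m x := by
  have hτ := sub_pos.2 hτ1
  have hk0 : 0 < k := (div_pos hτ0 hτ).trans hk
  have hcos : ∀ x ∈ Metric.ball (l / 2) (Real.pi / (4 * k)),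
      0 < Real.cos (2 * k * (x - l / 2)) := by
    intro x hx
    rw [Metric.mem_ball, Real.dist_eq, lt_div_iff₀ (by positivity)] at hx
    refine Real.cos_pos_of_mem_Ioo (abs_lt.1 ?_)
    rw [abs_mul, abs_of_pos (by positivity)]
    linarith
  have hradius : l / 2 < Real.pi / (4 * k) := by
    rw [lt_div_iff₀ (by positivity)]
    linarith
  obtain ⟨m, hm, hpos, hmg⟩ := exists_contDiff_pos_eventuallyEq (c := l / 2)
    (g := fun x ↦ Real.cos (2 * k * (x - l / 2)) ^ ((1 - τ) / τ)) (by linarith) hradius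
    fun x hx ↦ ⟨ContDiffAt.rpow_const_of_ne (by fun_prop) (hcos x hx).ne',
      Real.rpow_pos_of_pos (hcos x hx) _⟩
  refine ⟨m, hm, hpos, fun x hx ↦ ?_⟩
  have hxl : x ∈ Metric.closedBall (l / 2) (l / 2) := by
    rw [Metric.mem_closedBall, Real.dist_eq, abs_le]
    constructor <;> linarith [hx.1, hx.2]
  rw [riccatiDefect_congr (hmg x hxl), riccatiDefect_cos_rpow hτ0.ne'
    (hcos x (Metric.closedBall_subset_ball hradius hxl))]
  rw [div_lt_iff₀ hτ] at hk
  exact div_pos (by nlinarith) hτ0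

end Riccati

section LowerBound

lemma hermitian_form_nonneg {α γ : ℝ} {κ x y : ℂ} (hα : 0 < α) (h : Complex.normSq κ ≤ α * γ) :
    0 ≤ α * Complex.normSq y + 2 * (conj (x * κ) * y).re + γ * Complex.normSq x := by
  have hsquare : α * (α * Complex.normSq y + 2 * (conj (x * κ) * y).re + γ * Complex.normSq x) =
      Complex.normSq (α * y + x * κ) + Complex.normSq x * (α * γ - Complex.normSq κ) := by
    simp [Complex.normSq_apply]
    ring
  have hnonneg : 0 ≤ Complex.normSq x * (α * γ - Complex.normSq κ) :=
    mul_nonneg (Complex.normSq_nonneg x) (sub_nonneg.2 h)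
  refine nonneg_of_mul_nonneg_right ?_ hα
  rw [hsquare]
  exact add_nonneg (Complex.normSq_nonneg _) hnonneg

variable {lam m : ℝ → ℝ} {r τ : ℝ} {p : ℂ × ℂ}

/-- The off-diagonal coefficient `κ` of the Hermitian form
`(1 - τ) |F|² |∂ρ|² + 2 Re (conj (x κ) ∂ρ) + γ |x|²` in `∂ρ` and `x = -ρ η`, with
`F = fibre p`, which up to nonnegative terms is the form `powerLeviForm` of the weighted worm
function on `frame p η T`. -/
noncomputable def crossCoeff (lam : ℝ → ℝ) (r : ℝ) (m : ℝ → ℝ) (τ : ℝ) (p : ℂ × ℂ) : ℂ :=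
  ⟨τ * (deriv m (Real.log ‖p.1‖) / m (Real.log ‖p.1‖)) * Complex.normSq (fibre p) / 2 -
    tilt lam r p, (fibre p).re⟩

/-- The coefficient `γ` in the Hermitian form described at `crossCoeff`. -/
noncomputable def diagCoeff (m : ℝ → ℝ) (τ : ℝ) (p : ℂ × ℂ) : ℝ :=
  (fibre p).re ^ 2 - Complex.normSq (fibre p) *
    (deriv (deriv m) (Real.log ‖p.1‖) / m (Real.log ‖p.1‖) -
      (1 - τ) * (deriv m (Real.log ‖p.1‖) / m (Real.log ‖p.1‖)) ^ 2) / 4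

/-- The discriminant of the Hermitian form described at `crossCoeff`. -/
noncomputable def discriminant (lam : ℝ → ℝ) (r : ℝ) (m : ℝ → ℝ) (τ : ℝ) (p : ℂ × ℂ) : ℝ :=
  (1 - τ) * Complex.normSq (fibre p) * diagCoeff m τ p -
    Complex.normSq (crossCoeff lam r m τ p)

lemma powerLeviForm_weightedWorm (hlam : IsConvexProfile lam) (hm : ContDiff ℝ 2 m)
    (hp : p.1 ≠ 0) (η T : ℂ) :
    powerLeviForm (weightedWorm lam r m) τ p (frame p η T) =
      -weightedWorm lam r m p *
        (4 * leviForm (wormFunction lam r) p (frame p η T) * m (Real.log ‖p.1‖) +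
          wormFunction lam r p * (Complex.normSq η * deriv (deriv m) (Real.log ‖p.1‖)) +
          4 * deriv m (Real.log ‖p.1‖) * (conj η * slope lam r p η T).re) +
      (1 - τ) * Complex.normSq (2 * m (Real.log ‖p.1‖) * slope lam r p η T +
        wormFunction lam r p * deriv m (Real.log ‖p.1‖) * η) := by
  rw [powerLeviForm, four_mul_leviForm_weightedWorm hlam hm hp, fderiv_weightedWorm hlam hm hp,
    fderiv_weightedWorm hlam hm hp, fderiv_wormFunction_frame hlam hp,
    fderiv_wormFunction_I_smul_frame hlam hp, I_smul_frame, fderiv_weight_frame hm hp,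
    fderiv_weight_frame hm hp]
  simp [Complex.normSq_apply, -mul_eq_mul_left_iff]
  ring

lemma normSq_fibre_mul_powerLeviForm (hlam : IsConvexProfile lam) (hm : ContDiff ℝ 2 m)
    (hp : p.1 ≠ 0) (hpos : 0 < m (Real.log ‖p.1‖)) (η T : ℂ) :
    Complex.normSq (fibre p) * powerLeviForm (weightedWorm lam r m) τ p (frame p η T) =
      4 * m (Real.log ‖p.1‖) ^ 2 *
        ((1 - τ) * Complex.normSq (fibre p) * Complex.normSq (slope lam r p η T) +
          2 * (conj ((-wormFunction lam r p : ℝ) * η * crossCoeff lam r m τ p) *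
            slope lam r p η T).re +
          diagCoeff m τ p * Complex.normSq ((-wormFunction lam r p : ℝ) * η) +
        -wormFunction lam r p *
          (Complex.normSq (slope lam r p η T) + Complex.normSq η * slack lam r p)) := by
  have hlevi := normSq_fibre_mul_leviForm (r := r) hlam hp η T
  rw [powerLeviForm_weightedWorm hlam hm hp, weightedWorm, crossCoeff, diagCoeff]
  set M := m (Real.log ‖p.1‖)
  rw [show deriv m (Real.log ‖p.1‖) = M * (deriv m (Real.log ‖p.1‖) / M) by field_simp,
    show deriv (deriv m) (Real.log ‖p.1‖) = M * (deriv (deriv m) (Real.log ‖p.1‖) / M) by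
      field_simp]
  simp only [mul_div_cancel_left₀ _ hpos.ne']
  generalize deriv m (Real.log ‖p.1‖) / M = p₁
  generalize deriv (deriv m) (Real.log ‖p.1‖) / M = p₂
  generalize leviForm (wormFunction lam r) p (frame p η T) = L at *
  generalize slope lam r p η T = E at *
  simp [Complex.normSq_apply] at hlevi ⊢
  linear_combination (-wormFunction lam r p * M ^ 2) * hlevi

lemma powerLeviForm_weightedWorm_nonneg (hlam : IsConvexProfile lam) (hm : ContDiff ℝ 2 m)
    (hp : p.1 ≠ 0) (hpos : 0 < m (Real.log ‖p.1‖)) (hτ : τ < 1) (hneg : wormFunction lam r p < 0)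
    (hfibre : fibre p ≠ 0) (hdisc : 0 ≤ discriminant lam r m τ p) (t : ℂ × ℂ) :
    0 ≤ powerLeviForm (weightedWorm lam r m) τ p t := by
  obtain ⟨η, T, rfl⟩ := exists_eq_frame hp t
  have hV : 0 < Complex.normSq (fibre p) := Complex.normSq_pos.2 hfibre
  have hform := hermitian_form_nonneg (x := (-wormFunction lam r p : ℝ) * η)
    (y := slope lam r p η T) (mul_pos (sub_pos.2 hτ) hV) (sub_nonneg.1 hdisc)
  have hrest : 0 ≤ -wormFunction lam r p *
      (Complex.normSq (slope lam r p η T) + Complex.normSq η * slack lam r p) :=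
    mul_nonneg (neg_nonneg.2 hneg.le) (add_nonneg (Complex.normSq_nonneg _)
      (mul_nonneg (Complex.normSq_nonneg _) (slack_nonneg hlam r p)))
  refine nonneg_of_mul_nonneg_right ?_ hV
  rw [normSq_fibre_mul_powerLeviForm hlam hm hp hpos]
  exact mul_nonneg (by positivity) (add_nonneg hform hrest)

lemma continuousAt_fibre (hp : p.1 ≠ 0) : ContinuousAt fibre p :=
  continuousAt_const.add (continuousAt_snd.mul (Complex.continuous_conj.continuousAt.comp
    (contDiffAt_phase (n := 0) hp).continuousAt))

lemma continuousAt_comp_log_norm {g : ℝ → ℝ} (hg : Continuous g) (hp : p.1 ≠ 0) :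
    ContinuousAt (fun q : ℂ × ℂ ↦ g (Real.log ‖q.1‖)) p :=
  hg.continuousAt.comp (contDiffAt_log_norm (n := 0) hp).continuousAt

lemma continuousAt_discriminant (hlam : IsConvexProfile lam) (r : ℝ) (hm : ContDiff ℝ 2 m)
    (hp : p.1 ≠ 0) (hpos : 0 < m (Real.log ‖p.1‖)) :
    ContinuousAt (discriminant lam r m τ) p := by
  have hfibre := continuousAt_fibre hp
  have hre : ContinuousAt (fun q ↦ (fibre q).re) p :=
    Complex.continuous_re.continuousAt.comp hfibre
  have him : ContinuousAt (fun q ↦ (fibre q).im) p :=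
    Complex.continuous_im.continuousAt.comp hfibre
  have hcollar := continuousAt_comp_log_norm
    ((contDiff_collar hlam r).continuous_deriv (by simp)) hp
  have hm' : ContDiff ℝ 1 (deriv m) := ((contDiff_succ_iff_deriv (n := 1)).1 hm).2.2
  have hm₀ := continuousAt_comp_log_norm hm.continuous hp
  have hm₁ : ContinuousAt (fun q : ℂ × ℂ ↦ deriv m (Real.log ‖q.1‖) / m (Real.log ‖q.1‖)) p :=
    (continuousAt_comp_log_norm hm'.continuous hp).div hm₀ hpos.ne'
  have hm₂ : ContinuousAt
      (fun q : ℂ × ℂ ↦ deriv (deriv m) (Real.log ‖q.1‖) / m (Real.log ‖q.1‖)) p :=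
    (continuousAt_comp_log_norm (hm'.continuous_deriv le_rfl) hp).div hm₀ hpos.ne'
  unfold discriminant diagCoeff crossCoeff tilt
  simp only [Complex.normSq_apply]
  fun_prop

lemma discriminant_of_mem_annulus (hlam : IsConvexProfile lam) (hr : 0 < r)
    (hp : p ∈ annulus r) :
    discriminant lam r m τ p = riccatiDefect τ m (Real.log ‖p.1‖) := by
  simp [discriminant, diagCoeff, crossCoeff, tilt, riccatiDefect, Complex.normSq_apply,
    fibre_of_mem_annulus hp,
    deriv_collar_eq_zero hlam hr (log_norm_mem_Icc_of_mem_annulus hr hp)]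
  ring

lemma eventually_powerLeviForm_weightedWorm_nonneg (hlam : IsConvexProfile lam) (hr : 0 < r)
    (hm : ContDiff ℝ 2 m) (hpos : ∀ x, 0 < m x) (hτ : τ < 1) (hp : p ∈ annulus r)
    (hriccati : 0 < riccatiDefect τ m (Real.log ‖p.1‖)) :
    ∀ᶠ q in 𝓝 p, q ∈ wormDomain lam r → ∀ t, 0 ≤ powerLeviForm (weightedWorm lam r m) τ q t := by
  have hp0 := fst_ne_zero_of_mem_annulus hp
  have hfibre : fibre p ≠ 0 := by simp [fibre_of_mem_annulus hp]
  rw [← discriminant_of_mem_annulus hlam hr hp] at hriccati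
  filter_upwards [(continuousAt_fibre hp0).eventually_ne hfibre,
    (continuousAt_discriminant hlam r hm hp0 (hpos _)).eventually (lt_mem_nhds hriccati)]
    with q hq hdisc hqΩ
  exact powerLeviForm_weightedWorm_nonneg hlam hm hqΩ.1 (hpos _) hτ hqΩ.2 hq hdisc.le

lemma isDFExponent_wormDomain (hlam : IsConvexProfile lam) (hr : 1 < r) (hτ0 : 0 < τ)
    (hτ1 : τ < 1) (hτ : 2 * (τ / (1 - τ)) * Real.log r < Real.pi) :
    IsDFExponent (wormDomain lam r) τ := by
  have hl := Real.log_pos hr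
  obtain ⟨k, hk, hkr⟩ : ∃ k, τ / (1 - τ) < k ∧ k < Real.pi / (2 * Real.log r) :=
    exists_between (by rw [lt_div_iff₀ (by positivity)]; linarith)
  rw [lt_div_iff₀ (by positivity)] at hkr
  obtain ⟨m, hm, hpos, hriccati⟩ := exists_weight hτ0 hτ1 hk hl.le (by linarith)
  have hm2 : ContDiff ℝ 2 m := hm.of_le (by norm_cast)
  have hdef := isDefiningFunction_weightedWorm hlam hr.le hm hpos
  refine isDFExponent_of_eventually (isOpen_wormDomain hlam r)
    (isCompact_closure_wormDomain hlam r) hτ0 hτ1 hdef fun q hq ↦ ?_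
  have hr0 := zero_lt_one.trans hr
  by_cases hM : q ∈ annulus r
  · exact eventually_powerLeviForm_weightedWorm_nonneg hlam hr0 hm2 hpos hτ1 hM
      (hriccati _ (log_norm_mem_Icc_of_mem_annulus hr0 hM))
  · have hdef2 : IsDefiningFunction 2 _ _ := hdef.of_le (by norm_cast)
    filter_upwards [eventually_powerLeviForm_nonneg hτ1
      (hdef2.contDiffAt (frontier_subset_closure hq)) (hdef2.eq_zero hq)
      (isStrictlyPseudoconvexAt_wormDomain hlam hr.le hq hM _ hdef2)] with p hp hpΩ
    exact hp (hdef2.apply_neg hpΩ)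

end LowerBound

section Leaf

/-- The fibre coordinate of the leaves `leaf c k ε`. -/
noncomputable def leafFibre (c k : ℝ) (ζ : ℂ) : ℂ :=
  -Complex.exp (2 * Complex.I * c + 2 * Complex.I * (1 + k) * ζ)

/-- Holomorphic curves collapsing onto the annulus `w = 0` as `ε → 0`. The exponent in `leafFibre`
makes the direction of collapse turn by the angle `2 k Re ζ` against the inner normal
`-e^{i log |z|²}` of the worm domain. -/
noncomputable def leaf (c k ε : ℝ) (ζ : ℂ) : ℂ × ℂ :=
  (Complex.exp (c + ζ), ε * leafFibre c k ζ)

/-- The rate at which `-ρ` grows in `ε` along the leaves, at `ε = 0`. -/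
noncomputable def leafSlope (ρ : ℂ × ℂ → ℝ) (c k : ℝ) (ζ : ℂ) : ℝ :=
  -fderiv ℝ ρ (leaf c k 0 ζ) (0, leafFibre c k ζ)

variable {f : ℂ × ℂ → ℝ} {c k ε r : ℝ} {ζ : ℂ}

lemma leaf_zero (c k : ℝ) (ζ : ℂ) : leaf c k 0 ζ = (Complex.exp (c + ζ), 0) := by
  simp [leaf]

lemma leaf_eq (c k ε : ℝ) (ζ : ℂ) : leaf c k ε ζ = leaf c k 0 ζ + ε • (0, leafFibre c k ζ) := by
  simp [leaf]

lemma continuous_leafFibre (c k : ℝ) : Continuous (leafFibre c k) := by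
  unfold leafFibre
  fun_prop

lemma continuous_leaf (c k ε : ℝ) : Continuous (leaf c k ε) := by
  unfold leaf leafFibre
  fun_prop

lemma hasDerivAt_leafFibre (c k : ℝ) (ζ : ℂ) :
    HasDerivAt (leafFibre c k) (2 * Complex.I * (1 + k) * leafFibre c k ζ) ζ :=
  (((hasDerivAt_id ζ).const_mul (2 * Complex.I * (1 + k))).const_add
    (2 * Complex.I * c)).cexp.neg.congr_deriv (by simp only [leafFibre, id]; ring)

lemma hasDerivAt_exp_const_add (c ζ : ℂ) :
    HasDerivAt (fun ζ ↦ Complex.exp (c + ζ)) (Complex.exp (c + ζ)) ζ := by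
  simpa using ((hasDerivAt_id ζ).const_add c).cexp

lemma hasDerivAt_leaf (c k ε : ℝ) (ζ : ℂ) :
    HasDerivAt (leaf c k ε)
      (Complex.exp (c + ζ), ε * (2 * Complex.I * (1 + k) * leafFibre c k ζ)) ζ :=
  (hasDerivAt_exp_const_add c ζ).prodMk ((hasDerivAt_leafFibre c k ζ).const_mul _)

lemma hasDerivAt_velocity_leaf (c k ε : ℝ) (ζ : ℂ) :
    HasDerivAt
      (fun ζ ↦ (Complex.exp (c + ζ), (ε * (2 * Complex.I * (1 + k) * leafFibre c k ζ) : ℂ)))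
      (Complex.exp (c + ζ), ε * (2 * Complex.I * (1 + k) * (2 * Complex.I * (1 + k) *
        leafFibre c k ζ))) ζ :=
  (hasDerivAt_exp_const_add c ζ).prodMk
    (((hasDerivAt_leafFibre c k ζ).const_mul _).const_mul _)

lemma exists_hasTwoJetAt_holomorphic_curve {γ γ' : ℂ → ℂ × ℂ} {γ'' : ℂ × ℂ}
    (hf : ContDiffAt ℝ 2 f (γ ζ)) (hγ : ∀ ξ, HasDerivAt γ (γ' ξ) ξ) (hγ' : HasDerivAt γ' γ'' ζ) :
    ∃ b₁ c₁ b₂ c₂ : ℝ, HasTwoJetAt (fun s : ℝ ↦ f (γ (ζ + s * 1))) b₁ c₁ 0 ∧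
      HasTwoJetAt (fun s : ℝ ↦ f (γ (ζ + s * Complex.I))) b₂ c₂ 0 ∧
      4 * leviForm f (γ ζ) (γ' ζ) = c₁ + c₂ := by
  have hline (u : ℂ) (s : ℝ) : HasDerivAt (fun s : ℝ ↦ ζ + s * u) u s := by
    simpa using ((Complex.ofRealCLM.hasDerivAt (x := s)).mul_const u).const_add ζ
  have hcurve (u : ℂ) (s : ℝ) :
      HasDerivAt (fun s : ℝ ↦ γ (ζ + s * u)) (u • γ' (ζ + s * u)) s :=
    (hγ _).scomp s (hline u s)
  have hvelocity (u : ℂ) :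
      HasDerivAt (fun s : ℝ ↦ u • γ' (ζ + s * u)) (u • u • γ'') 0 := by
    have hγ'_zero : HasDerivAt γ' γ'' (ζ + (0 : ℝ) * u) := by simpa using hγ'
    exact (hγ'_zero.scomp 0 (hline u 0)).const_smul u
  have hjet (u : ℂ) := HasTwoJetAt.comp_curve (F := f) (by simpa using hf) (hcurve u) (hvelocity u)
  refine ⟨_, _, _, _, hjet 1, hjet Complex.I, ?_⟩
  refine four_mul_leviForm_eq_of_curves hf (by simp) (by simp) (hcurve 1) (hcurve Complex.I)
    (hvelocity 1) ((hvelocity Complex.I).congr_deriv ?_) (by simp) (by simp) (hjet 1)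
    (hjet Complex.I)
  simp [smul_smul]

lemma log_norm_exp_add (c : ℝ) (ζ : ℂ) : Real.log ‖Complex.exp (c + ζ)‖ = c + ζ.re := by
  rw [Complex.norm_exp, Real.log_exp]
  simp

lemma leafFibre_eq_mul_phase (c k : ℝ) (ζ : ℂ) : leafFibre c k ζ =
    -Complex.exp (((-2 * (1 + k) * ζ.im : ℝ) : ℂ) + ((2 * k * ζ.re : ℝ) : ℂ) * Complex.I) *
      phase (Complex.exp (c + ζ)) := by
  rw [phase_eq, log_norm_exp_add, leafFibre, neg_mul, ← Complex.exp_add]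
  congr 2
  apply Complex.ext
  · simp
  · simp
    ring

lemma leaf_zero_mem_annulus (hr : 0 < r) (hζ : |ζ.re| ≤ Real.log r / 2) :
    leaf (Real.log r / 2) k 0 ζ ∈ annulus r := by
  have hlog := log_norm_exp_add (Real.log r / 2) ζ
  rw [leaf_zero]
  refine ⟨?_, ?_, rfl⟩ <;> rw [abs_le] at hζ
  · rw [← Real.log_nonneg_iff (by simp), hlog]
    linarith
  · rw [← Real.log_le_log_iff (by simp) hr, hlog]
    linarith

end Leaf

section Factor

/-- Half the derivative of `ρ` at `(z, 0)` in the direction `e^{i log |z|²}` of the `w`-plane. It is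
the factor by which `dρ` exceeds the differential of the standard defining function there. -/
noncomputable def annulusFactor (ρ : ℂ × ℂ → ℝ) (z : ℂ) : ℝ :=
  fderiv ℝ ρ (z, 0) (0, phase z) / 2

variable {lam : ℝ → ℝ} {ρ : ℂ × ℂ → ℝ} {r c k : ℝ} {z ζ : ℂ}

lemma annulusFactor_pos_and_fderiv_eq (hlam : IsConvexProfile lam) (hr : 1 ≤ r)
    (hρ : IsDefiningFunction 2 (wormDomain lam r) ρ) (hz : (z, 0) ∈ annulus r) :
    0 < annulusFactor ρ z ∧
      ∀ T : ℂ, fderiv ℝ ρ (z, 0) (0, T * phase z) = 2 * annulusFactor ρ z * T.re := by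
  have hr0 : 0 < r := by linarith
  obtain ⟨a, ha, hda, -⟩ := ((isDefiningFunction_wormFunction hlam hr).of_le
    (m := 2) (by norm_cast)).exists_leviForm_eq_mul hρ
    (annulus_subset_frontier_wormDomain hlam hr hz)
  have hfderiv (T : ℂ) : fderiv ℝ ρ (z, 0) (0, T * phase z) = 2 * a * T.re := by
    have hworm := fderiv_wormFunction_frame (r := r) hlam (fst_ne_zero_of_mem_annulus hz) 0 T
    rw [slope_of_mem_annulus hlam hr0 hz, frame, mul_zero] at hworm
    rw [hda, smul_apply, smul_eq_mul, hworm]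
    ring
  have hfactor : annulusFactor ρ z = a := by
    rw [annulusFactor, ← one_mul (phase z), hfderiv]
    simp
  exact hfactor ▸ ⟨ha, hfderiv⟩

lemma continuousAt_annulusFactor (hρ : ContDiffAt ℝ 1 ρ (z, 0)) (hz : z ≠ 0) :
    ContinuousAt (annulusFactor ρ) z := by
  have hfderiv : ContinuousAt (fun z : ℂ ↦ fderiv ℝ ρ (z, 0)) z :=
    ContinuousAt.comp (f := fun z : ℂ ↦ (z, (0 : ℂ)))
      (hρ.fderiv_right (m := 0) (by norm_num)).continuousAt (by fun_prop)
  have hphase : ContinuousAt phase z :=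
    ContinuousAt.comp (g := fun q : ℂ × ℂ ↦ phase q.1) (f := fun z : ℂ ↦ (z, (0 : ℂ)))
      (contDiffAt_phase (n := 0) (p := (z, 0)) hz).continuousAt (by fun_prop)
  exact (hfderiv.clm_apply (continuousAt_const.prodMk hphase)).div_const 2

lemma leafSlope_eq (hlam : IsConvexProfile lam) (hr : 1 ≤ r)
    (hρ : IsDefiningFunction 2 (wormDomain lam r) ρ) (hζ : leaf c k 0 ζ ∈ annulus r) :
    leafSlope ρ c k ζ = 2 * annulusFactor ρ (Complex.exp (c + ζ)) *
      (Real.exp (-2 * (1 + k) * ζ.im) * Real.cos (2 * k * ζ.re)) := by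
  rw [leaf_zero] at hζ
  rw [leafSlope, leaf_zero, leafFibre_eq_mul_phase,
    (annulusFactor_pos_and_fderiv_eq hlam hr hρ hζ).2, Complex.neg_re, Complex.exp_re]
  simp

end Factor

section Barrier

/-- An eigenfunction of the Laplacian, with eigenvalue `4 (K ^ 2 - k ^ 2)`. -/
noncomputable def barrier (K k : ℝ) (ζ : ℂ) : ℝ :=
  Real.exp (-2 * K * ζ.im) * Real.cos (2 * k * ζ.re)

lemma continuous_barrier (K k : ℝ) : Continuous (barrier K k) := by
  unfold barrier
  fun_prop

lemma exists_hasTwoJetAt_barrier_one (K k : ℝ) (ζ : ℂ) :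
    ∃ b, HasTwoJetAt (fun s : ℝ ↦ barrier K k (ζ + s * 1)) b (-(4 * k ^ 2 * barrier K k ζ)) 0 := by
  have hcos := (hasTwoJetAt_cos _).comp (HasTwoJetAt.affine (2 * k * ζ.re) (2 * k) 0)
  refine ⟨_, ((hcos.const_mul (Real.exp (-2 * K * ζ.im))).congr_of_eventuallyEq
    (.of_forall fun s ↦ ?_)).congr_jet rfl ?_⟩
  · simp [barrier, mul_add]
  · simp [barrier]
    ring

lemma exists_hasTwoJetAt_barrier_I (K k : ℝ) (ζ : ℂ) :
    ∃ b, HasTwoJetAt (fun s : ℝ ↦ barrier K k (ζ + s * Complex.I)) b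
      (4 * K ^ 2 * barrier K k ζ) 0 := by
  have hexp := (HasTwoJetAt.of_contDiffAt Real.contDiff_exp.contDiffAt).comp
    (HasTwoJetAt.affine (-2 * K * ζ.im) (-2 * K) 0)
  refine ⟨_, ((hexp.const_mul (Real.cos (2 * k * ζ.re))).congr_of_eventuallyEq
    (.of_forall fun s ↦ ?_)).congr_jet rfl ?_⟩
  · simp [barrier, mul_add, mul_comm (Real.cos _)]
  · simp [barrier]
    ring

lemma exists_hasTwoJetAt_dist_sq {u : ℂ} (hu : ‖u‖ = 1) (ζ ζ₀ : ℂ) :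
    ∃ b, HasTwoJetAt (fun s : ℝ ↦ dist (ζ + s * u) ζ₀ ^ 2) b 2 0 := by
  have hquadratic := (HasTwoJetAt.affine (‖ζ - ζ₀‖ ^ 2) (2 * inner ℝ (ζ - ζ₀) u) 0).add
    (HasTwoJetAt.affine 0 1 0).sq
  refine ⟨_, (hquadratic.congr_of_eventuallyEq (.of_forall fun s ↦ ?_)).congr_jet rfl (by simp)⟩
  simp only [dist_eq_norm, add_sub_right_comm ζ, ← Complex.real_smul,
    norm_add_sq_real (ζ - ζ₀), norm_smul, real_inner_smul_right, hu, Real.norm_eq_abs, mul_one,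
    sq_abs]
  ring

lemma add_nonpos_of_isLocalMax {E : ℂ → ℝ} {ζ : ℂ} {b₁ c₁ b₂ c₂ : ℝ} (hmax : IsLocalMax E ζ)
    (h₁ : HasTwoJetAt (fun s : ℝ ↦ E (ζ + s * 1)) b₁ c₁ 0)
    (h₂ : HasTwoJetAt (fun s : ℝ ↦ E (ζ + s * Complex.I)) b₂ c₂ 0) : c₁ + c₂ ≤ 0 := by
  have hmax_line (u : ℂ) : IsLocalMax (fun s : ℝ ↦ E (ζ + s * u)) 0 := by
    have hline : Continuous fun s : ℝ ↦ ζ + (s : ℂ) * u := by fun_prop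
    have htendsto : Tendsto (fun s : ℝ ↦ ζ + (s : ℂ) * u) (𝓝 0) (𝓝 ζ) := by
      simpa using hline.tendsto 0
    simpa [IsLocalMax, IsMaxFilter] using htendsto.eventually hmax
  exact add_nonpos (h₁.nonpos_of_isLocalMax (hmax_line 1))
    (h₂.nonpos_of_isLocalMax (hmax_line Complex.I))

end Barrier

section Touching

lemma exists_isLocalMax_of_touching {X : Type*} [PseudoMetricSpace X] [ProperSpace X]
    {v φ ψ : X → ℝ} {x₀ : X} {R μ : ℝ} (hR : 0 < R)
    (hv : ContinuousOn v (Metric.closedBall x₀ R)) (hψ : ContinuousOn ψ (Metric.closedBall x₀ R))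
    (hle : ∀ x ∈ Metric.closedBall x₀ R, v x ≤ φ x) (heq : v x₀ = φ x₀)
    (hclose : ∀ x ∈ Metric.closedBall x₀ R, |ψ x - φ x| < μ * R ^ 2 / 2) :
    ∃ x ∈ Metric.ball x₀ R, IsLocalMax (fun x ↦ v x - μ * dist x x₀ ^ 2 - ψ x) x := by
  have hx₀ : x₀ ∈ Metric.closedBall x₀ R := Metric.mem_closedBall_self hR.le
  have hcont : ContinuousOn (fun x ↦ v x - μ * dist x x₀ ^ 2 - ψ x) (Metric.closedBall x₀ R) := by
    fun_prop
  obtain ⟨x, hx, hmax⟩ := (isCompact_closedBall x₀ R).exists_isMaxOn ⟨_, hx₀⟩ hcont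
  have hball : x ∈ Metric.ball x₀ R := by
    by_contra hsphere
    have hdist : dist x x₀ = R := le_antisymm hx (not_lt.1 hsphere)
    have hmax₀ : v x₀ - μ * dist x₀ x₀ ^ 2 - ψ x₀ ≤ v x - μ * dist x x₀ ^ 2 - ψ x := hmax hx₀
    rw [dist_self, hdist] at hmax₀
    linarith [abs_lt.1 (hclose x hx), abs_lt.1 (hclose x₀ hx₀), hle x hx]
  exact ⟨x, hball, hmax.isLocalMax
    (mem_of_superset (Metric.isOpen_ball.mem_nhds hball) Metric.ball_subset_closedBall)⟩

variable {Ω : Set (ℂ × ℂ)} {ρ : ℂ × ℂ → ℝ} {τ A K k c μ ε : ℝ} {ζ ζ₀ : ℂ}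

lemma mul_barrier_le_of_isLocalMax (hε : 0 ≤ ε)
    (hC : ContDiffAt ℝ 2 (fun p ↦ -((-ρ p) ^ τ)) (leaf c k ε ζ))
    (hpsh : ∀ t, 0 ≤ leviForm (fun p ↦ -((-ρ p) ^ τ)) (leaf c k ε ζ) t)
    (hmax : IsLocalMax (fun ξ ↦ A * barrier K k ξ - μ * dist ξ ζ₀ ^ 2 -
      (-ρ (leaf c k ε ξ)) ^ τ / ε ^ τ) ζ) :
    (K ^ 2 - k ^ 2) * (A * barrier K k ζ) ≤ μ := by
  obtain ⟨_, c₁, _, c₂, hjet₁, hjet₂, hsum⟩ := exists_hasTwoJetAt_holomorphic_curve hC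
    (hasDerivAt_leaf c k ε) (hasDerivAt_velocity_leaf c k ε ζ)
  obtain ⟨_, hbarrier₁⟩ := exists_hasTwoJetAt_barrier_one K k ζ
  obtain ⟨_, hbarrier₂⟩ := exists_hasTwoJetAt_barrier_I K k ζ
  obtain ⟨_, hdist₁⟩ := exists_hasTwoJetAt_dist_sq norm_one ζ ζ₀
  obtain ⟨_, hdist₂⟩ := exists_hasTwoJetAt_dist_sq Complex.norm_I ζ ζ₀
  have hlaplacian := add_nonpos_of_isLocalMax
    (E := fun ξ ↦ A * barrier K k ξ - μ * dist ξ ζ₀ ^ 2 +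
      (ε ^ τ)⁻¹ * -((-ρ (leaf c k ε ξ)) ^ τ))
    (by convert hmax using 2; ring)
    (((hbarrier₁.const_mul A).sub (hdist₁.const_mul μ)).add (hjet₁.const_mul (ε ^ τ)⁻¹))
    (((hbarrier₂.const_mul A).sub (hdist₂.const_mul μ)).add (hjet₂.const_mul (ε ^ τ)⁻¹))
  have hnonneg : 0 ≤ (ε ^ τ)⁻¹ * (c₁ + c₂) :=
    mul_nonneg (inv_nonneg.2 (Real.rpow_nonneg hε τ))
      (hsum ▸ mul_nonneg zero_le_four (hpsh _))
  linarith

lemma eventually_forall_of_forall_eventually_nhdsWithin {X Y : Type*} [TopologicalSpace X]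
    [TopologicalSpace Y] {x₀ : X} {s : Set X} {t : Set Y} (ht : IsCompact t) {P : X → Y → Prop}
    (hP : ∀ y ∈ t, ∀ᶠ q in 𝓝[s] x₀ ×ˢ 𝓝[t] y, P q.1 q.2) :
    ∀ᶠ x in 𝓝[s] x₀, ∀ y ∈ t, P x y := by
  have hforall : ∀ᶠ x in 𝓝 x₀, ∀ y ∈ t, x ∈ s → y ∈ t → P x y :=
    ht.eventually_forall_of_forall_eventually fun y hy ↦ by
      have hPy := hP y hy
      rw [← nhdsWithin_prod_eq, eventually_nhdsWithin_iff] at hPy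
      exact hPy.mono fun q hq hx hy ↦ hq ⟨hx, hy⟩
  filter_upwards [hforall.filter_mono nhdsWithin_le_nhds, self_mem_nhdsWithin] with x hx hxs y hy
  exact hx y hy hxs hy

lemma tendsto_div_of_hasStrictFDerivAt {E X : Type*} [NormedAddCommGroup E] [NormedSpace ℝ E]
    [TopologicalSpace X] {f : E → ℝ} {f' : E →L[ℝ] ℝ} {γ v : X → E} {x₀ : X} {t : Set X}
    (hf : HasStrictFDerivAt f f' (γ x₀)) (hγ : ContinuousWithinAt γ t x₀)
    (hv : ContinuousWithinAt v t x₀) (hzero : ∀ x ∈ t, f (γ x) = 0) :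
    Tendsto (fun q : ℝ × X ↦ f (γ q.2 + q.1 • v q.2) / q.1) (𝓝[>] 0 ×ˢ 𝓝[t] x₀)
      (𝓝 (f' (v x₀))) := by
  have hfst : Tendsto (fun q : ℝ × X ↦ q.1) (𝓝[>] 0 ×ˢ 𝓝[t] x₀) (𝓝 0) :=
    tendsto_fst.mono_right nhdsWithin_le_nhds
  have hγ_snd : Tendsto (fun q : ℝ × X ↦ γ q.2) (𝓝[>] 0 ×ˢ 𝓝[t] x₀) (𝓝 (γ x₀)) :=
    hγ.tendsto.comp tendsto_snd
  have hv_snd : Tendsto (fun q : ℝ × X ↦ v q.2) (𝓝[>] 0 ×ˢ 𝓝[t] x₀) (𝓝 (v x₀)) :=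
    hv.tendsto.comp tendsto_snd
  have hpair : Tendsto (fun q : ℝ × X ↦ (γ q.2 + q.1 • v q.2, γ q.2)) (𝓝[>] 0 ×ˢ 𝓝[t] x₀)
      (𝓝 (γ x₀, γ x₀)) := by
    simpa using (hγ_snd.add (hfst.smul hv_snd)).prodMk_nhds hγ_snd
  have hlittleO := ((hf.isLittleO.comp_tendsto hpair).congr_right (g₂ := fun q ↦ q.1 • v q.2)
    fun q ↦ add_sub_cancel_left _ _).trans_isBigO
    (((Asymptotics.isBigO_refl (fun q : ℝ × X ↦ q.1) _).smul (hv_snd.isBigO_one ℝ)).congr_right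
      (g₂ := fun q ↦ q.1) fun q ↦ mul_one _)
  have hsum := hlittleO.tendsto_div_nhds_zero.add ((f'.continuous.tendsto _).comp hv_snd)
  rw [zero_add] at hsum
  refine hsum.congr' ?_
  have hpos : ∀ᶠ q : ℝ × X in 𝓝[>] 0 ×ˢ 𝓝[t] x₀, 0 < q.1 :=
    tendsto_fst.eventually self_mem_nhdsWithin
  filter_upwards [hpos, tendsto_snd.eventually self_mem_nhdsWithin] with q hq hqt
  simp only [Function.comp_apply, hzero q.2 hqt, sub_zero, add_sub_cancel_left, map_smul,
    smul_eq_mul]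
  field_simp
  ring

lemma continuousAt_leafSlope (hρ : ContDiffAt ℝ 1 ρ (leaf c k 0 ζ)) :
    ContinuousAt (leafSlope ρ c k) ζ := by
  have hfderiv : ContinuousAt (fun ζ ↦ fderiv ℝ ρ (leaf c k 0 ζ)) ζ :=
    ContinuousAt.comp (f := leaf c k 0) (hρ.fderiv_right (m := 0) (by norm_num)).continuousAt
      (continuous_leaf c k 0).continuousAt
  exact (hfderiv.clm_apply
    (continuousAt_const.prodMk (continuous_leafFibre c k).continuousAt)).neg

lemma tendsto_neg_leaf_div {S : Set ℂ} (hρ : ContDiffAt ℝ 1 ρ (leaf c k 0 ζ))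
    (hzero : ∀ ξ ∈ S, ρ (leaf c k 0 ξ) = 0) :
    Tendsto (fun q : ℝ × ℂ ↦ -ρ (leaf c k q.1 q.2) / q.1) (𝓝[>] 0 ×ˢ 𝓝[S] ζ)
      (𝓝 (leafSlope ρ c k ζ)) := by
  have hfibre : Continuous fun ζ ↦ ((0, leafFibre c k ζ) : ℂ × ℂ) :=
    continuous_const.prodMk (continuous_leafFibre c k)
  refine (tendsto_div_of_hasStrictFDerivAt (hρ.hasStrictFDerivAt one_ne_zero)
    (continuous_leaf c k 0).continuousWithinAt hfibre.continuousWithinAt hzero).neg.congr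
    fun q ↦ ?_
  rw [← leaf_eq, neg_div]

lemma eventually_forall_leaf_mem_and_abs_sub_lt {S : Set ℂ} {δ : ℝ}
    (hρ : IsDefiningFunction 1 Ω ρ) (hS : IsCompact S)
    (hfr : ∀ ζ ∈ S, leaf c k 0 ζ ∈ frontier Ω) (hslope : ∀ ζ ∈ S, 0 < leafSlope ρ c k ζ)
    (hδ : 0 < δ) :
    ∀ᶠ ε in 𝓝[>] 0, ∀ ζ ∈ S, leaf c k ε ζ ∈ Ω ∧
      |(-ρ (leaf c k ε ζ)) ^ τ / ε ^ τ - leafSlope ρ c k ζ ^ τ| < δ := by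
  refine eventually_forall_of_forall_eventually_nhdsWithin hS fun ζ hζ ↦ ?_
  have hcl := frontier_subset_closure (hfr ζ hζ)
  have hleaf : Tendsto (fun q : ℝ × ℂ ↦ leaf c k q.1 q.2) (𝓝[>] 0 ×ˢ 𝓝[S] ζ)
      (𝓝 (leaf c k 0 ζ)) := by
    have hcont : Continuous fun q : ℝ × ℂ ↦ leaf c k q.1 q.2 := by unfold leaf leafFibre; fun_prop
    refine (hcont.tendsto (0, ζ)).mono_left ?_
    rw [nhds_prod_eq]
    exact prod_mono nhdsWithin_le_nhds nhdsWithin_le_nhds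
  have hquotient := tendsto_neg_leaf_div (hρ.contDiffAt hcl) fun ξ hξ ↦ hρ.eq_zero (hfr ξ hξ)
  have hslope_cont : Tendsto (fun q : ℝ × ℂ ↦ leafSlope ρ c k q.2) (𝓝[>] 0 ×ˢ 𝓝[S] ζ)
      (𝓝 (leafSlope ρ c k ζ)) :=
    ((continuousAt_leafSlope (hρ.contDiffAt hcl)).mono_left nhdsWithin_le_nhds).comp tendsto_snd
  have hne := (hslope ζ hζ).ne'
  have hdiff := ((hquotient.rpow_const (p := τ) (.inl hne)).sub
    (hslope_cont.rpow_const (p := τ) (.inl hne))).abs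
  rw [sub_self, abs_zero] at hdiff
  have hpos : ∀ᶠ q : ℝ × ℂ in 𝓝[>] 0 ×ˢ 𝓝[S] ζ, 0 < q.1 :=
    tendsto_fst.eventually self_mem_nhdsWithin
  filter_upwards [hdiff.eventually (gt_mem_nhds hδ), hpos,
    hquotient.eventually (lt_mem_nhds (hslope ζ hζ)), hleaf.eventually (hρ.eventually_mem_iff hcl)]
    with q hlt hq hneg hmem
  have hρq : 0 < -ρ (leaf c k q.1 q.2) := (div_pos_iff_of_pos_right hq).1 hneg
  rw [Real.div_rpow hρq.le hq.le] at hlt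
  exact ⟨hmem.2 (neg_pos.1 hρq), hlt⟩

lemma not_touching (hΩ : IsOpen Ω) (hρ : IsDefiningFunction 1 Ω ρ)
    (hpsh : IsPlurisubharmonicOn (fun p ↦ -((-ρ p) ^ τ)) Ω) (hkK : k ^ 2 < K ^ 2)
    (hpos : 0 < A * barrier K k ζ₀) (hfr : ∀ᶠ ζ in 𝓝 ζ₀, leaf c k 0 ζ ∈ frontier Ω)
    (hslope : ∀ᶠ ζ in 𝓝 ζ₀, 0 < leafSlope ρ c k ζ)
    (hle : ∀ᶠ ζ in 𝓝 ζ₀, A * barrier K k ζ ≤ leafSlope ρ c k ζ ^ τ) :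
    A * barrier K k ζ₀ ≠ leafSlope ρ c k ζ₀ ^ τ := by
  intro heq
  have hK : 0 < K ^ 2 - k ^ 2 := sub_pos.2 hkK
  have hbarrier : Continuous fun ζ ↦ A * barrier K k ζ := (continuous_barrier K k).const_mul A
  obtain ⟨R, hR, hball⟩ := Metric.nhds_basis_closedBall.eventually_iff.1
    (hfr.and (hslope.and (hle.and (hbarrier.continuousAt.eventually
      (lt_mem_nhds (half_lt_self hpos))))))
  set μ := (K ^ 2 - k ^ 2) * (A * barrier K k ζ₀ / 2)
  have hμ : 0 < μ := mul_pos hK (half_pos hpos)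
  obtain ⟨ε, hclose, hε⟩ := ((eventually_forall_leaf_mem_and_abs_sub_lt (τ := τ) hρ
    (isCompact_closedBall ζ₀ R) (fun ζ hζ ↦ (hball hζ).1) (fun ζ hζ ↦ (hball hζ).2.1)
    (half_pos (mul_pos hμ (pow_pos hR 2)))).and self_mem_nhdsWithin).exists
  have hC (ζ) (hζ : ζ ∈ Metric.closedBall ζ₀ R) :
      ContDiffAt ℝ 2 (fun p ↦ -((-ρ p) ^ τ)) (leaf c k ε ζ) :=
    hpsh.1.contDiffAt (hΩ.mem_nhds (hclose ζ hζ).1)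
  have hcont : ContinuousOn (fun ζ ↦ (-ρ (leaf c k ε ζ)) ^ τ / ε ^ τ) (Metric.closedBall ζ₀ R) :=
    fun ζ hζ ↦ by
      have hrpow := (hC ζ hζ).continuousAt.neg.comp (continuous_leaf c k ε).continuousAt
      simp only [neg_neg, Function.comp_def, Pi.neg_def] at hrpow
      exact (hrpow.div_const _).continuousWithinAt
  obtain ⟨ζ₁, hζ₁, hmax⟩ := exists_isLocalMax_of_touching hR hbarrier.continuousOn hcont
    (fun ζ hζ ↦ (hball hζ).2.2.1) heq fun ζ hζ ↦ (hclose ζ hζ).2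
  have hζ₁' := Metric.ball_subset_closedBall hζ₁
  exact (mul_barrier_le_of_isLocalMax (le_of_lt hε) (hC ζ₁ hζ₁') (hpsh.2 _ (hclose ζ₁ hζ₁').1)
    hmax).not_gt (mul_lt_mul_of_pos_left (hball hζ₁').2.2.2 hK)

end Touching

section BarrierRatio

/-- The quotient of `barrier (τ * (1 + k)) k` by the `τ`-th power of `leafSlope ρ c k`, written so
that it extends continuously to the zeros of the cosine. -/
noncomputable def barrierRatio (ρ : ℂ × ℂ → ℝ) (τ c k : ℝ) (ζ : ℂ) : ℝ :=
  Real.cos (2 * k * ζ.re) ^ (1 - τ) / (2 * annulusFactor ρ (Complex.exp (c + ζ))) ^ τ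

variable {lam : ℝ → ℝ} {ρ : ℂ × ℂ → ℝ} {r τ c k : ℝ} {ζ : ℂ}

lemma periodic_barrierRatio (ρ : ℂ × ℂ → ℝ) (τ c k : ℝ) :
    Function.Periodic (barrierRatio ρ τ c k) ((2 * Real.pi : ℝ) * Complex.I) := fun ζ ↦ by
  have hexp : Complex.exp (c + (ζ + (2 * Real.pi : ℝ) * Complex.I)) = Complex.exp (c + ζ) := by
    simpa [add_assoc] using Complex.exp_periodic (c + ζ)
  rw [barrierRatio, barrierRatio, hexp]
  simp

lemma annulusFactor_exp_pos (hlam : IsConvexProfile lam) (hr : 1 ≤ r)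
    (hρ : IsDefiningFunction 2 (wormDomain lam r) ρ) (hζ : leaf c k 0 ζ ∈ annulus r) :
    0 < annulusFactor ρ (Complex.exp (c + ζ)) :=
  (annulusFactor_pos_and_fderiv_eq hlam hr hρ (leaf_zero c k ζ ▸ hζ)).1

lemma continuousAt_barrierRatio (hlam : IsConvexProfile lam) (hr : 1 ≤ r)
    (hρ : IsDefiningFunction 2 (wormDomain lam r) ρ) (hτ : τ ≤ 1)
    (hζ : leaf c k 0 ζ ∈ annulus r) : ContinuousAt (barrierRatio ρ τ c k) ζ := by
  have hpos := annulusFactor_exp_pos hlam hr hρ hζ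
  have hρ₁ : ContDiffAt ℝ 1 ρ (leaf c k 0 ζ) := (hρ.contDiffAt (frontier_subset_closure
    (annulus_subset_frontier_wormDomain hlam hr hζ))).of_le one_le_two
  rw [leaf_zero] at hρ₁
  have hfactor : ContinuousAt (fun ζ ↦ annulusFactor ρ (Complex.exp (c + ζ))) ζ :=
    ContinuousAt.comp (g := annulusFactor ρ)
      (continuousAt_annulusFactor hρ₁ (Complex.exp_ne_zero _)) (by fun_prop)
  have hcos : ContinuousAt (fun ζ : ℂ ↦ Real.cos (2 * k * ζ.re)) ζ := by fun_prop
  exact (hcos.rpow_const (.inr (sub_nonneg.2 hτ))).div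
    ((hfactor.const_mul 2).rpow_const (.inl (by positivity))) (by positivity)

lemma leafSlope_pos (hlam : IsConvexProfile lam) (hr : 1 ≤ r)
    (hρ : IsDefiningFunction 2 (wormDomain lam r) ρ) (hζ : leaf c k 0 ζ ∈ annulus r)
    (hcos : 0 < Real.cos (2 * k * ζ.re)) : 0 < leafSlope ρ c k ζ := by
  have hpos := annulusFactor_exp_pos hlam hr hρ hζ
  rw [leafSlope_eq hlam hr hρ hζ]
  positivity

lemma barrier_eq_barrierRatio_mul (hlam : IsConvexProfile lam) (hr : 1 ≤ r)
    (hρ : IsDefiningFunction 2 (wormDomain lam r) ρ) (hζ : leaf c k 0 ζ ∈ annulus r)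
    (hcos : 0 < Real.cos (2 * k * ζ.re)) :
    barrier (τ * (1 + k)) k ζ = barrierRatio ρ τ c k ζ * leafSlope ρ c k ζ ^ τ := by
  have hpos := annulusFactor_exp_pos hlam hr hρ hζ
  have hne : (2 * annulusFactor ρ (Complex.exp (c + ζ))) ^ τ ≠ 0 := by positivity
  have hexp : Real.exp (-2 * (τ * (1 + k)) * ζ.im) = Real.exp (-2 * (1 + k) * ζ.im) ^ τ := by
    rw [← Real.exp_mul]
    ring_nf
  have hsplit : Real.cos (2 * k * ζ.re) ^ (1 - τ) * Real.cos (2 * k * ζ.re) ^ τ =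
      Real.cos (2 * k * ζ.re) := by
    rw [← Real.rpow_add hcos, sub_add_cancel, Real.rpow_one]
  rw [leafSlope_eq hlam hr hρ hζ, Real.mul_rpow (by positivity) (by positivity),
    Real.mul_rpow (Real.exp_pos _).le hcos.le, barrierRatio, ← mul_assoc, div_mul_cancel₀ _ hne,
    barrier, hexp, mul_left_comm, hsplit]

lemma leaf_zero_mem_annulus_of_abs_le (hr : 0 < r) (hk : 0 < k)
    (hkr : Real.pi ≤ 2 * k * Real.log r) (hζ : |2 * k * ζ.re| ≤ Real.pi / 2) :
    leaf (Real.log r / 2) k 0 ζ ∈ annulus r := by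
  refine leaf_zero_mem_annulus hr (le_of_mul_le_mul_left ?_ (by positivity : 0 < 2 * k))
  rw [abs_mul, abs_of_pos (by positivity)] at hζ
  linarith

lemma cos_pos_of_abs_lt {x : ℝ} (hx : |x| < Real.pi / 2) : 0 < Real.cos x :=
  Real.cos_pos_of_mem_Ioo (abs_lt.1 hx)

lemma exists_forall_le_of_periodic {g : ℂ → ℝ} {s : Set ℝ} {T : ℝ} (hs : IsCompact s)
    (hne : s.Nonempty) (hT : 0 < T) (hg : ContinuousOn g (Complex.re ⁻¹' s))
    (hper : Function.Periodic g (T * Complex.I)) :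
    ∃ ζ₀, ζ₀.re ∈ s ∧ ∀ ζ, ζ.re ∈ s → g ζ ≤ g ζ₀ := by
  have hcompact_ne : (s ×ℂ Set.Icc 0 T).Nonempty :=
    let ⟨x, hx⟩ := hne
    ⟨x, by simpa [Complex.mem_reProdIm] using ⟨hx, hT.le⟩⟩
  obtain ⟨ζ₀, hζ₀, hmax⟩ := (hs.reProdIm (isCompact_Icc (a := 0) (b := T))).exists_isMaxOn
    hcompact_ne (hg.mono fun ζ hζ ↦ hζ.1)
  refine ⟨ζ₀, hζ₀.1, fun ζ hζ ↦ ?_⟩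
  have hper_im : Function.Periodic (fun t : ℝ ↦ g (ζ.re + t * Complex.I)) T := fun t ↦ by
    simpa [add_mul, add_assoc] using hper (ζ.re + t * Complex.I)
  obtain ⟨t, ht, heq⟩ := hper_im.exists_mem_Ico₀ hT ζ.im
  simp only [Complex.re_add_im] at heq
  rw [heq]
  exact hmax ⟨by simpa using hζ, by simpa using ⟨ht.1, ht.2.le⟩⟩

lemma exists_forall_barrierRatio_le (hlam : IsConvexProfile lam) (hr : 1 ≤ r)
    (hρ : IsDefiningFunction 2 (wormDomain lam r) ρ) (hτ : τ < 1) (hk : 0 < k)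
    (hkr : Real.pi ≤ 2 * k * Real.log r) :
    ∃ ζ₀ : ℂ, |2 * k * ζ₀.re| < Real.pi / 2 ∧ 0 < barrierRatio ρ τ (Real.log r / 2) k ζ₀ ∧
      ∀ ζ : ℂ, |2 * k * ζ.re| ≤ Real.pi / 2 →
        barrierRatio ρ τ (Real.log r / 2) k ζ ≤ barrierRatio ρ τ (Real.log r / 2) k ζ₀ := by
  have hmem {ζ : ℂ} (hζ : |2 * k * ζ.re| ≤ Real.pi / 2) :=
    leaf_zero_mem_annulus_of_abs_le (by linarith) hk hkr hζ
  have hstrip (x : ℝ) : x ∈ Metric.closedBall 0 (Real.pi / 2 / (2 * k)) ↔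
      |2 * k * x| ≤ Real.pi / 2 := by
    rw [mem_closedBall_zero_iff, Real.norm_eq_abs, le_div_iff₀' (by positivity), abs_mul (2 * k),
      abs_of_pos (by positivity : 0 < 2 * k)]
  have hzero : |2 * k * (0 : ℂ).re| ≤ Real.pi / 2 := by simpa using Real.pi_div_two_pos.le
  obtain ⟨ζ₀, hζ₀, hmax⟩ := exists_forall_le_of_periodic
    (isCompact_closedBall 0 (Real.pi / 2 / (2 * k))) ⟨0, (hstrip _).2 hzero⟩ Real.two_pi_pos
    (fun ζ hζ ↦ (continuousAt_barrierRatio hlam hr hρ hτ.le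
      (hmem ((hstrip _).1 hζ))).continuousWithinAt)
    (periodic_barrierRatio ρ τ (Real.log r / 2) k)
  simp only [hstrip] at hζ₀ hmax
  have hpos : 0 < barrierRatio ρ τ (Real.log r / 2) k ζ₀ := by
    have hfactor := annulusFactor_exp_pos hlam hr hρ (hmem hzero)
    refine lt_of_lt_of_le ?_ (hmax 0 hzero)
    rw [barrierRatio, Complex.zero_re, mul_zero, Real.cos_zero]
    positivity
  refine ⟨ζ₀, hζ₀.lt_of_ne fun hedge ↦ hpos.ne' ?_, hpos, hmax⟩
  rw [barrierRatio, ← Real.cos_abs, hedge, Real.cos_pi_div_two,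
    Real.zero_rpow (sub_pos.2 hτ).ne', zero_div]

end BarrierRatio

section Index

variable {lam : ℝ → ℝ} {ρ : ℂ × ℂ → ℝ} {r τ k : ℝ}

lemma not_isPlurisubharmonicOn_of_lt (hlam : IsConvexProfile lam) (hr : 1 ≤ r)
    (hρ : IsDefiningFunction 2 (wormDomain lam r) ρ) (hτ : τ < 1) (hk : 0 < k)
    (hkr : Real.pi ≤ 2 * k * Real.log r) (hkτ : k < τ * (1 + k)) :
    ¬ IsPlurisubharmonicOn (fun p ↦ -((-ρ p) ^ τ)) (wormDomain lam r) := by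
  intro hpsh
  obtain ⟨ζ₀, hζ₀, hpos, hmax⟩ := exists_forall_barrierRatio_le hlam hr hρ hτ hk hkr
  have hmem {ζ : ℂ} (hζ : |2 * k * ζ.re| < Real.pi / 2) :=
    leaf_zero_mem_annulus_of_abs_le (by linarith) hk hkr hζ.le
  have hslope {ζ : ℂ} (hζ : |2 * k * ζ.re| < Real.pi / 2) :=
    leafSlope_pos hlam hr hρ (hmem hζ) (cos_pos_of_abs_lt hζ)
  have hbarrier {ζ : ℂ} (hζ : |2 * k * ζ.re| < Real.pi / 2) :=
    barrier_eq_barrierRatio_mul (τ := τ) hlam hr hρ (hmem hζ) (cos_pos_of_abs_lt hζ)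
  have hcont : Continuous fun ζ : ℂ ↦ |2 * k * ζ.re| := by fun_prop
  have hnear := hcont.continuousAt.eventually (gt_mem_nhds hζ₀)
  refine not_touching (A := (barrierRatio ρ τ (Real.log r / 2) k ζ₀)⁻¹)
    (isOpen_wormDomain hlam r) (hρ.of_le one_le_two) hpsh
    (pow_lt_pow_left₀ hkτ hk.le two_ne_zero) ?_
    (hnear.mono fun ζ hζ ↦ annulus_subset_frontier_wormDomain hlam hr (hmem hζ))
    (hnear.mono fun ζ hζ ↦ hslope hζ) (hnear.mono fun ζ hζ ↦ ?_) ?_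
  · exact mul_pos (inv_pos.2 hpos) (mul_pos (Real.exp_pos _) (cos_pos_of_abs_lt hζ₀))
  · rw [hbarrier hζ, inv_mul_le_iff₀ hpos]
    exact mul_le_mul_of_nonneg_right (hmax ζ hζ.le) (Real.rpow_nonneg (hslope hζ).le τ)
  · rw [hbarrier hζ₀, inv_mul_cancel_left₀ hpos.ne']

lemma le_of_isDFExponent (hlam : IsConvexProfile lam) (hr : 1 < r)
    (h : IsDFExponent (wormDomain lam r) τ) : 2 * (τ / (1 - τ)) * Real.log r ≤ Real.pi := by
  obtain ⟨-, hτ, ρ, hρ, hpsh⟩ := h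
  have hlog := Real.log_pos hr
  by_contra! hlt
  obtain ⟨k, hπk, hkτ⟩ : ∃ k, Real.pi / (2 * Real.log r) < k ∧ k < τ / (1 - τ) :=
    exists_between (by rw [div_lt_iff₀ (by positivity)]; linarith)
  have hk : 0 < k := lt_trans (by positivity) hπk
  rw [div_lt_iff₀ (by positivity)] at hπk
  rw [lt_div_iff₀ (sub_pos.2 hτ)] at hkτ
  exact not_isPlurisubharmonicOn_of_lt hlam hr.le (hρ.of_le (by norm_cast)) hτ hk
    (by linarith) (by linarith) hpsh

lemma dfIndex_wormDomain (hlam : IsConvexProfile lam) (hr : 1 < r) :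
    dfIndex (wormDomain lam r) = Real.pi / (Real.log (r ^ 2) + Real.pi) := by
  have hlog := Real.log_pos hr
  have hπ := Real.pi_pos
  have hlog_sq : Real.log (r ^ 2) = 2 * Real.log r := by
    rw [Real.log_pow, Nat.cast_ofNat]
  have hassoc (τ : ℝ) : 2 * (τ / (1 - τ)) * Real.log r = 2 * τ * Real.log r / (1 - τ) := by ring
  have hindex_pos : 0 < Real.pi / (Real.log (r ^ 2) + Real.pi) := by
    rw [hlog_sq]
    positivity
  have hexponent : ∀ τ ∈ Set.Ioo 0 (Real.pi / (Real.log (r ^ 2) + Real.pi)),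
      IsDFExponent (wormDomain lam r) τ := by
    rintro τ ⟨hτ₀, hτ⟩
    rw [hlog_sq, lt_div_iff₀ (by positivity)] at hτ
    have hτ₁ : τ < 1 := by nlinarith
    refine isDFExponent_wormDomain hlam hr hτ₀ hτ₁ ?_
    rw [hassoc, div_lt_iff₀ (sub_pos.2 hτ₁)]
    linarith
  have hle : ∀ τ, IsDFExponent (wormDomain lam r) τ →
      τ ≤ Real.pi / (Real.log (r ^ 2) + Real.pi) := by
    intro τ h
    have hupper := le_of_isDFExponent hlam hr h
    rw [hassoc, div_le_iff₀ (sub_pos.2 h.2.1)] at hupper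
    rw [hlog_sq, le_div_iff₀ (by positivity)]
    linarith
  have hlub : IsLUB {τ | IsDFExponent (wormDomain lam r) τ}
      (Real.pi / (Real.log (r ^ 2) + Real.pi)) :=
    ⟨hle, fun b hb ↦ (isLUB_Ioo hindex_pos).2 fun τ hτ ↦ hb (hexponent τ hτ)⟩
  exact hlub.csSup_eq ((Set.nonempty_Ioo.2 hindex_pos).mono hexponent)

end Index

end Worm

theorem mainTheorem5_general (lam : ℝ → ℝ) (hlam : Worm.IsConvexProfile lam) (r : ℝ) (hr : 1 < r) :
    Worm.IsPseudoconvex (Worm.wormDomain lam r) ∧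
    Worm.weaklyPseudoconvexPoints (Worm.wormDomain lam r) =
      {p : ℂ × ℂ | 1 ≤ ‖p.1‖ ∧ ‖p.1‖ ≤ r ∧ p.2 = 0} ∧
    Worm.dfIndex (Worm.wormDomain lam r) = Real.pi / (Real.log (r ^ 2) + Real.pi) :=
  ⟨Worm.isPseudoconvex_wormDomain hlam hr.le, Worm.weaklyPseudoconvexPoints_wormDomain hlam hr.le,
    Worm.dfIndex_wormDomain hlam hr⟩

theorem mainTheorem5 (lam : ℝ → ℝ) (hlam : Worm.IsWormProfile lam) (r : ℝ) (hr : 1 < r) :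
    Worm.IsPseudoconvex (Worm.wormDomain lam r) ∧
    Worm.weaklyPseudoconvexPoints (Worm.wormDomain lam r) =
      {p : ℂ × ℂ | 1 ≤ ‖p.1‖ ∧ ‖p.1‖ ≤ r ∧ p.2 = 0} ∧
    Worm.dfIndex (Worm.wormDomain lam r) = Real.pi / (Real.log (r ^ 2) + Real.pi) :=
  mainTheorem5_general lam hlam.isConvexProfile r hr
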